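/- **Model.** A typical node sits at the origin of $\mathbb{R}^2$. The other nodes are the points $X_0,X_1,\dots$ of a homogeneous Poisson point process of density $\lambda>0$. In a time slot every node (the typical node included) transmits with probability $\rho\in[0,1]$ and otherwise receives; each node uses one of $M\ge 1$ resource blocks, chosen uniformly. Node $j$ carries a pair $(h_j,g_j)$ of Nakagami fading power gains (for its signal as a desired signal, resp. as interference), where $h_j$ is Gamma distributed with shape and rate $m_s$, and $g_j$ is Gamma distributed with shape and rate $m_i$ ($m_s,m_i$ positive integers; the joint law of the pair is arbitrary but fixed, e.g. $h_j,g_j$ independent, or $h_j=g_j$ if $m_s=m_i$), and a shadowing power gain $\vartheta_j>0$. Fading pair, shadowing, transmission state and resource block of a node are independent, these marks are i.i.d. over the nodes, and locations, marks and the state of the typical node are independent. With path loss exponent $\alpha>2$ and noise-to-transmit-power ratio $\sigma^2$, the received SINR for node $i$ is $$\Xi_i=\frac{h_i\,\vartheta_i\,|X_i|^{-\alpha}}{\sum_{j} g_j\,\vartheta_j\,|X_j|^{-\alpha}+\sigma^2},$$ the sum running over the transmitting nodes $j\ne i$ on the resource block of node $i$. For a threshold $\xi>0$, $S$ is the number of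 nodes $i$ such that the typical node receives, node $i$ transmits, and $\Xi_i>\xi$. **Statement.** Let $\sigma^2=0$ (the interference-limited case) and suppose that $\mathbb{E}\{\vartheta^{2/\alpha}\}<\infty$. Then: 1. the displaced points $\vartheta_j^{-1/\alpha}X_j$ form a homogeneous Poisson point process of density $\lambda\,\mathbb{E}\{\vartheta^{2/\alpha}\}$; 2. $\mathbb{E}\{S\}$ is finite and depends neither on the distribution of the shadowing $\vartheta$ nor on the density $\lambda$: for any two densities $\lambda_1,\lambda_2>0$ and any two laws $\nu_1,\nu_2$ of a positive shadowing gain with finite $2/\alpha$-th moment (for instance $\vartheta\equiv 1$, no shadowing), the two corresponding models, all else being equal, have the same $\mathbb{E}\{S\}<\infty$. -/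

import Mathlib

open MeasureTheory ProbabilityTheory

noncomputable section

/-- The plane, with its Euclidean norm and Lebesgue measure. -/
abbrev Plane : Type := EuclideanSpace ℝ (Fin 2)

/-- The number of points of the family `X` that lie in the set `B`. -/
def pointCount {Ω : Type*} (X : ℕ → Ω → Plane) (B : Set Plane) (ω : Ω) : ℕ∞ :=
  {i : ℕ | X i ω ∈ B}.encard

/-- The random points `X 0, X 1, …` form a homogeneous Poisson point process of density `lam`
(points per unit area) on the plane: the number of points in a Borel set of finite area is Poisson
with mean `lam * area`, and the numbers of points in disjoint such sets are independent. -/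
structure IsHomogeneousPPP {Ω : Type*} [MeasurableSpace Ω] (P : Measure Ω)
    (X : ℕ → Ω → Plane) (lam : ℝ) : Prop where
  measurable : ∀ i, Measurable (X i)
  poisson : ∀ B : Set Plane, MeasurableSet B → volume B < ⊤ → ∀ k : ℕ,
    P {ω | pointCount X B ω = k} =
      poissonMeasure (Real.toNNReal (lam * (volume B).toReal)) {k}
  indep : ∀ (n : ℕ) (B : Fin n → Set Plane), (∀ l, MeasurableSet (B l)) →
    (∀ l, volume (B l) < ⊤) → Pairwise (Function.onFun Disjoint B) →
    iIndepFun (fun l => pointCount X (B l)) P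

/-- The random quantities of one time slot of the multichannel random hello protocol with `M`
resource blocks, seen by a typical node at the origin. -/
structure HelloNetwork (Ω : Type*) (M : ℕ) where
  /-- location of node `i` -/
  X : ℕ → Ω → Plane
  /-- Nakagami fading power gain of node `i` when it is the target node -/
  h : ℕ → Ω → ℝ
  /-- Nakagami fading power gain of node `i` when it is an interferer -/
  g : ℕ → Ω → ℝ
  /-- shadowing power gain of the link from node `i` to the typical node -/
  θ : ℕ → Ω → ℝ
  /-- `Z i ω = true` if node `i` transmits, `false` if it receives -/
  Z : ℕ → Ω → Bool
  /-- the resource block that node `i` uses when it transmits -/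
  K : ℕ → Ω → Fin M
  /-- transmission state of the typical node -/
  Z₀ : Ω → Bool

namespace HelloNetwork

variable {Ω : Type*} {M : ℕ} (N : HelloNetwork Ω M)

/-- Fading gains, shadowing gain, transmission state and resource block of node `i`. -/
def mark (i : ℕ) (ω : Ω) : (ℝ × ℝ) × ℝ × Bool × Fin M :=
  ((N.h i ω, N.g i ω), N.θ i ω, N.Z i ω, N.K i ω)

/-- Received power, per unit transmit power, of the desired signal when node `i` is the target. -/
def signal (α : ℝ) (i : ℕ) (ω : Ω) : ENNReal :=
  ENNReal.ofReal (N.h i ω * N.θ i ω) * ENNReal.ofReal ‖N.X i ω‖ ^ (-α)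

open Classical in
/-- Total received power, per unit transmit power, of the other nodes transmitting over the
resource block of node `i`. -/
def interference (α : ℝ) (i : ℕ) (ω : Ω) : ENNReal :=
  ∑' j : ℕ, if j ≠ i ∧ N.Z j ω = true ∧ N.K j ω = N.K i ω then
    ENNReal.ofReal (N.g j ω * N.θ j ω) * ENNReal.ofReal ‖N.X j ω‖ ^ (-α) else 0

/-- Received SINR for node `i`; `σsq` is the noise power divided by the transmit power. -/
def sinr (α σsq : ℝ) (i : ℕ) (ω : Ω) : ENNReal :=
  N.signal α i ω / (N.interference α i ω + ENNReal.ofReal σsq)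

/-- The nodes that the typical node discovers over all resource blocks: the typical node receives,
the target node transmits, and its packet is received with SINR above `ξ`. -/
def discovered (α ξ σsq : ℝ) (ω : Ω) : Set ℕ :=
  {i | N.Z₀ ω = false ∧ N.Z i ω = true ∧ ENNReal.ofReal ξ < N.sinr α σsq i ω}

/-- The average number `E{S}` of successfully discovered nodes. -/
def meanDiscovered [MeasurableSpace Ω] (P : Measure Ω) (α ξ σsq : ℝ) : ENNReal :=
  ∫⁻ ω, ((N.discovered α ξ σsq ω).encard : ENNReal) ∂P

/-- Locations of the nodes displaced according to their shadowing. -/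
def displaced (α : ℝ) (i : ℕ) (ω : Ω) : Plane :=
  (N.θ i ω ^ (-1 / α)) • N.X i ω

end HelloNetwork

/-- The law on `Bool` of a node's transmission state: `true` (transmit) with probability `ρ`. -/
def transmitLaw (ρ : ℝ) : Measure Bool :=
  ENNReal.ofReal ρ • Measure.dirac true + ENNReal.ofReal (1 - ρ) • Measure.dirac false

/-- A law of the pair `(h, g)` of fading gains of a node under Nakagami fading with parameters `ms`
(desired signal) and `mi` (interfering signal): each gain has the Gamma law with mean `1`. -/
def IsNakagamiPair (ms mi : ℕ) (κ : Measure (ℝ × ℝ)) : Prop :=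
  κ.map Prod.fst = gammaMeasure ms ms ∧ κ.map Prod.snd = gammaMeasure mi mi

/-- Stochastic model: the nodes form a homogeneous Poisson process of density `lam`; their marks are
i.i.d., and within a mark the pair of fading gains (law `κ`), the shadowing gain (law `ν`), the
transmission state (probability `ρ`) and the resource block (uniform) are independent; the
locations, the marks and the state of the typical node are independent. -/
structure HelloNetwork.IsModel {Ω : Type*} [MeasurableSpace Ω] {M : ℕ} (N : HelloNetwork Ω M)
    (P : Measure Ω) (lam ρ : ℝ) (κ : Measure (ℝ × ℝ)) (ν : Measure ℝ) : Prop where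
  ppp : IsHomogeneousPPP P N.X lam
  measurable_mark : ∀ i, Measurable (N.mark i)
  measurable_state : Measurable N.Z₀
  law_mark : ∀ i, P.map (N.mark i) =
    κ.prod (ν.prod ((transmitLaw ρ).prod (uniformOn (Set.univ : Set (Fin M)))))
  law_state : P.map N.Z₀ = transmitLaw ρ
  indep_mark : iIndepFun N.mark P
  indep_mark_state : IndepFun (fun ω i => N.mark i ω) N.Z₀ P
  indep_location : IndepFun (fun ω i => N.X i ω) (fun ω => (fun i => N.mark i ω, N.Z₀ ω)) P

/-- A law of the shadowing power gain: it is positive and its `2 / α`-th moment is finite. -/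
structure IsShadowingLaw (α : ℝ) (ν : Measure ℝ) : Prop where
  prob : IsProbabilityMeasure ν
  pos : ∀ᵐ t ∂ν, 0 < t
  moment : Integrable (fun t : ℝ => t ^ (2 / α)) ν

end

/-! Since `θ * ‖x‖ ^ (-α) = ‖θ ^ (-1 / α) • x‖ ^ (-α)`, the shadowing enters a received power only
by displacing the node. Scaling all displaced points by `c` changes every power by the same factor,
which cancels in the SINR when there is no noise. By the marking and mapping theorems the points `c
• θ ^ (-1 / α) • X`, carrying the remaining marks, are Poisson with spatial density `lam * c⁻² * E θ
^ (2 / α)`. A suitable `c` makes this density `1`, so any two models reduce to Poisson processes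
with the same intensity (`map_reduce`, `exists_hasPoissonLaplace_points`).

Nothing is known about the law of the enumeration `X 0, X 1, …` beyond the counts, so the argument
runs through Laplace functionals `E exp (-∑ φ (X j))`, which ignore the order of the points.
`IsHomogeneousPPP.hasPoissonLaplace` and `HasPoissonLaplace.isHomogeneousPPP` translate between
counts and functionals; `prodMk` and `map` are marking and mapping. The Mecke formula
`sum_map_prodMk_sumOthers` then expresses the mean number of successes through the intensity and the
law of the total interference, and the Laplace functional fixes that law (`map_tsum_eq`). This gives
the invariance.

For finiteness (`prod_successSet_lt_top`), scaling makes the Laplace transform of the interference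
`exp (-A * s ^ (2 / α))` with `A > 0`. A Chernoff bound at `s = ξ * ‖x‖ ^ α / h` dominates the
success probability of a node at `x` by a Gaussian in `x`. Its integral is a multiple of `h ^ (2 /
α)`, which has finite mean because `2 / α ≤ 1`. -/

open Filter Topology
open scoped ENNReal

/-! ### The exponential `exp (-x)` on `[0, ∞]` -/

/-- The function `x ↦ exp (-x)` on the extended nonnegative reals, with `exp (-∞) = 0`. -/
noncomputable def negExp (x : ℝ≥0∞) : ℝ≥0∞ := EReal.exp (-(x : EReal))

@[simp] lemma negExp_zero : negExp 0 = 1 := by simp [negExp]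

@[simp] lemma negExp_top : negExp ⊤ = 0 := by simp [negExp]

lemma negExp_ofReal {a : ℝ} (ha : 0 ≤ a) :
    negExp (ENNReal.ofReal a) = ENNReal.ofReal (Real.exp (-a)) := by
  rw [negExp, EReal.coe_ennreal_ofReal, max_eq_left ha, ← EReal.coe_neg, EReal.exp_coe]

lemma negExp_add (x y : ℝ≥0∞) : negExp (x + y) = negExp x * negExp y := by
  simp [negExp, EReal.exp_neg, EReal.exp_add, ENNReal.mul_inv]

lemma continuous_negExp : Continuous negExp :=
  ENNReal.continuous_exp.comp (continuous_neg.comp continuous_coe_ennreal_ereal)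

lemma measurable_negExp : Measurable negExp := continuous_negExp.measurable

lemma negExp_strictAnti : StrictAnti negExp := fun x y h => by
  simpa [negExp] using h

lemma negExp_le_one (x : ℝ≥0∞) : negExp x ≤ 1 := by
  simpa using negExp_strictAnti.antitone (zero_le (a := x))

lemma negExp_ne_top (x : ℝ≥0∞) : negExp x ≠ ⊤ := ((negExp_le_one x).trans_lt ENNReal.one_lt_top).ne

lemma negExp_ne_zero {x : ℝ≥0∞} (hx : x ≠ ⊤) : negExp x ≠ 0 := by
  simpa using (negExp_strictAnti hx.lt_top).ne'

lemma negExp_sum {ι : Type*} (s : Finset ι) (f : ι → ℝ≥0∞) :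
    negExp (∑ i ∈ s, f i) = ∏ i ∈ s, negExp (f i) := by
  classical
  induction s using Finset.induction_on with
  | empty => simp
  | insert a s ha ih => rw [Finset.sum_insert ha, Finset.prod_insert ha, negExp_add, ih]

lemma negExp_nat_mul (n : ℕ) (x : ℝ≥0∞) : negExp (n * x) = negExp x ^ n := by
  simpa using negExp_sum (Finset.range n) fun _ => x

lemma tendsto_prod_negExp (f : ℕ → ℝ≥0∞) :
    Tendsto (fun n => ∏ i ∈ Finset.range n, negExp (f i)) atTop (𝓝 (negExp (∑' i, f i))) := by
  simp_rw [← negExp_sum]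
  exact (continuous_negExp.tendsto _).comp ENNReal.summable.hasSum.tendsto_sum_nat

/-- The inverse of `negExp` on `[0, 1]`. -/
noncomputable def negLog (u : ℝ≥0∞) : ℝ≥0∞ := (-(ENNReal.log u)).toENNReal

lemma measurable_negLog : Measurable negLog :=
  (ENNReal.measurable_log.neg).ereal_toENNReal

lemma negExp_negLog {u : ℝ≥0∞} (hu : u ≤ 1) : negExp (negLog u) = u := by
  have : 0 ≤ -(ENNReal.log u) := by
    rw [EReal.le_neg, neg_zero]; simpa using ENNReal.log_monotone hu
  rw [negExp, negLog, EReal.coe_toENNReal this, neg_neg, ENNReal.exp_log]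

lemma one_sub_negExp_add (x y : ℝ≥0∞) :
    1 - negExp (x + y) = (1 - negExp x) + negExp x * (1 - negExp y) := by
  rw [negExp_add, ENNReal.mul_sub (fun _ _ => negExp_ne_top x), mul_one,
    tsub_add_tsub_cancel (negExp_le_one x)]
  exact mul_le_of_le_one_right' (negExp_le_one y)

lemma one_sub_negExp_le (x : ℝ≥0∞) : 1 - negExp x ≤ x := by
  rcases eq_or_ne x ⊤ with rfl | hx
  · simp
  lift x to NNReal using hx
  have : (x : ℝ≥0∞) = ENNReal.ofReal (x : ℝ) := by simp
  have hx0 : (0 : ℝ) ≤ x := x.2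
  rw [this, negExp_ofReal hx0, ← ENNReal.ofReal_one, ← ENNReal.ofReal_sub _ (Real.exp_nonneg _)]
  apply ENNReal.ofReal_le_ofReal
  linarith [Real.add_one_le_exp (-(x : ℝ))]

lemma one_sub_negExp_mono : Monotone fun x => 1 - negExp x := fun _ _ h =>
  tsub_le_tsub_left (negExp_strictAnti.antitone h) _

/-- Halving the argument loses nothing: `1 - u ^ 2 = (1 - u) + u * (1 - u) ≤ 2 * (1 - u)`. Dyadic
scales are used so that monotone convergence applies. -/
lemma monotone_two_pow_mul_one_sub_negExp (x : ℝ≥0∞) :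
    Monotone fun k : ℕ => (2 : ℝ≥0∞) ^ k * (1 - negExp (x / 2 ^ k)) := by
  refine monotone_nat_of_le_succ fun k => ?_
  have h : x / 2 ^ k = x / 2 ^ (k + 1) + x / 2 ^ (k + 1) := by
    rw [← ENNReal.add_halves (x / 2 ^ k), pow_succ, ENNReal.div_eq_inv_mul, ENNReal.div_eq_inv_mul,
      ENNReal.div_eq_inv_mul, ENNReal.mul_inv (by simp) (by simp)]
    ring
  rw [h, one_sub_negExp_add, pow_succ, mul_assoc]
  gcongr
  rw [two_mul]
  gcongr
  exact mul_le_of_le_one_left' (negExp_le_one _)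

/-- A difference quotient of `s ↦ 1 - exp (-s * x)` at `s = 0`. It recovers a sum over the points
from exponential functionals in the proof of the Mecke formula. -/
lemma iSup_two_pow_mul_one_sub_negExp (x : ℝ≥0∞) :
    ⨆ k : ℕ, (2 : ℝ≥0∞) ^ k * (1 - negExp (x / 2 ^ k)) = x := by
  refine iSup_eq_of_tendsto (monotone_two_pow_mul_one_sub_negExp x) ?_
  rcases eq_or_ne x ⊤ with rfl | hx
  · have : ∀ k : ℕ, (⊤ : ℝ≥0∞) / 2 ^ k = ⊤ := fun k => ENNReal.top_div_of_ne_top (by simp)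
    simp [this, ENNReal.tendsto_pow_atTop_nhds_top_iff]
  lift x to NNReal using hx
  have hr : Tendsto (fun k : ℕ => ENNReal.ofReal (2 ^ k * (1 - Real.exp (-(x / 2 ^ k))))) atTop
      (𝓝 (ENNReal.ofReal x)) := by
    refine ENNReal.tendsto_ofReal ?_
    -- Lower half of a squeeze: `exp (-y) ≤ 1 / (1 + y)` gives `1 - exp (-y) ≥ y / (1 + y)` with `y
    -- = x / 2 ^ k`.
    have hlim : Tendsto (fun k : ℕ => (x : ℝ) / (1 + x / 2 ^ k)) atTop (𝓝 x) := by
      have h0 : Tendsto (fun k : ℕ => (x : ℝ) / 2 ^ k) atTop (𝓝 0) :=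
        tendsto_const_nhds.div_atTop (tendsto_pow_atTop_atTop_of_one_lt one_lt_two)
      have := (tendsto_const_nhds (x := (x : ℝ))).div (tendsto_const_nhds.add h0)
        (by norm_num : (1 : ℝ) + 0 ≠ 0)
      simp only [add_zero, div_one] at this
      exact this
    refine tendsto_of_tendsto_of_tendsto_of_le_of_le hlim tendsto_const_nhds (fun k => ?_)
      (fun k => ?_)
    · set y : ℝ := x / 2 ^ k with hy
      have hy0 : 0 ≤ y := by positivity
      have hx : (x : ℝ) = 2 ^ k * y := by rw [hy]; field_simp
      have h1 : Real.exp (-y) ≤ 1 / (1 + y) := by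
        rw [Real.exp_neg, ← one_div]
        exact one_div_le_one_div_of_le (by linarith) (by linarith [Real.add_one_le_exp y])
      change (x : ℝ) / (1 + y) ≤ _
      rw [hx, mul_div_assoc]
      gcongr
      have : y / (1 + y) = 1 - 1 / (1 + y) := by field_simp; ring
      linarith
    · have := Real.add_one_le_exp (-((x : ℝ) / 2 ^ k))
      have h2 : 1 - Real.exp (-((x : ℝ) / 2 ^ k)) ≤ x / 2 ^ k := by linarith
      calc (2 : ℝ) ^ k * (1 - Real.exp (-((x : ℝ) / 2 ^ k))) ≤ 2 ^ k * (x / 2 ^ k) := by gcongr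
        _ = x := by field_simp
  have hx : (x : ℝ≥0∞) = ENNReal.ofReal (x : ℝ) := by simp
  rw [hx]
  refine hr.congr fun k => ?_
  have h2 : (2 : ℝ≥0∞) ^ k = ENNReal.ofReal (2 ^ k) := by
    rw [ENNReal.ofReal_pow (by norm_num)]; norm_num
  rw [h2, ← ENNReal.ofReal_div_of_pos (by positivity), negExp_ofReal (by positivity),
    ENNReal.ofReal_mul (by positivity), ENNReal.ofReal_sub _ (Real.exp_nonneg _),
    ENNReal.ofReal_one]

/-- The diagonal form of `iSup_two_pow_mul_one_sub_negExp`. -/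
lemma iSup_two_pow_mul_one_sub_negExp_diag {y : ℕ → ℝ≥0∞} (hy : Monotone y) :
    ⨆ k : ℕ, (2 : ℝ≥0∞) ^ k * (1 - negExp (y k / 2 ^ k)) = ⨆ k, y k := by
  refine le_antisymm (iSup_mono fun k => ?_) (iSup_le fun m => ?_)
  · calc (2 : ℝ≥0∞) ^ k * (1 - negExp (y k / 2 ^ k)) ≤ 2 ^ k * (y k / 2 ^ k) := by
          gcongr; exact one_sub_negExp_le _
      _ ≤ y k := ENNReal.mul_div_le
  · rw [← iSup_two_pow_mul_one_sub_negExp (y m)]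
    refine iSup_le fun n => le_iSup_of_le (max m n) ?_
    refine (monotone_two_pow_mul_one_sub_negExp (y m) (le_max_right m n)).trans ?_
    dsimp only
    gcongr
    exact negExp_strictAnti.antitone (ENNReal.div_le_div_right (hy (le_max_left m n)) _)

/-! ### Uniqueness of measures with given Laplace transforms -/

/-- Finite measures on a finite power of `[0, ∞]` are determined by their Laplace transforms at
natural arguments. -/
theorem measure_pi_ext_of_lintegral_negExp {ι : Type*} [Fintype ι]
    {μ ν : Measure (ι → ℝ≥0∞)} [IsFiniteMeasure μ] [IsFiniteMeasure ν]
    (h : ∀ k : ι → ℕ, ∫⁻ x, negExp (∑ l, k l * x l) ∂μ = ∫⁻ x, negExp (∑ l, k l * x l) ∂ν) :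
    μ = ν := by
  classical
  have hcont : ∀ k : ι → ℕ, Continuous fun x : ι → ℝ≥0∞ => negExp (∑ l, k l * x l) := fun k =>
    continuous_negExp.comp (continuous_finsetSum _ fun l _ =>
      (ENNReal.continuous_const_mul (by simp)).comp (continuous_apply l))
  have hcont' : ∀ k : ι → ℕ, Continuous fun x : ι → ℝ≥0∞ => (negExp (∑ l, k l * x l)).toReal :=
    fun k => ENNReal.continuousOn_toReal.comp_continuous (hcont k) fun x => negExp_ne_top _
  let F : (ι → ℕ) → BoundedContinuousFunction (ι → ℝ≥0∞) ℝ := fun k =>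
    BoundedContinuousFunction.mkOfCompact ⟨_, hcont' k⟩
  have hF : ∀ k x, F k x = (negExp (∑ l, k l * x l)).toReal := fun k x => rfl
  -- The exponentials are closed under multiplication, so the algebra they generate is their linear
  -- span. It separates points, and equality of integrals need only be checked on the exponentials.
  let S : Submonoid (BoundedContinuousFunction (ι → ℝ≥0∞) ℝ) :=
    { carrier := Set.range F
      one_mem' := ⟨0, by ext x; simp [hF]⟩
      mul_mem' := by
        rintro _ _ ⟨k, rfl⟩ ⟨k', rfl⟩
        refine ⟨k + k', ?_⟩
        ext x
        simp [hF, add_mul, Finset.sum_add_distrib, negExp_add] }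
  let A : StarSubalgebra ℝ (BoundedContinuousFunction (ι → ℝ≥0∞) ℝ) :=
    { Algebra.adjoin ℝ (S : Set (BoundedContinuousFunction (ι → ℝ≥0∞) ℝ)) with
      star_mem' := fun {a} ha => by
        have : star a = a := by ext x; simp
        rwa [this] }
  refine ext_of_forall_mem_subalgebra_integral_eq_of_polish (𝕜 := ℝ) (A := A) ?_ ?_
  · intro x y hxy
    obtain ⟨l, hl⟩ := Function.ne_iff.1 hxy
    refine ⟨_, ⟨_, ⟨F (Pi.single l 1), Algebra.subset_adjoin ⟨_, rfl⟩, rfl⟩, rfl⟩, ?_⟩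
    have hsum : ∀ z : ι → ℝ≥0∞, ∑ m, ((Pi.single l 1 : ι → ℕ) m : ℝ≥0∞) * z m = z l := by
      intro z
      rw [Finset.sum_eq_single l] <;> simp +contextual
    change F (Pi.single l 1) x ≠ F (Pi.single l 1) y
    rw [hF, hF, hsum, hsum, Ne, ENNReal.toReal_eq_toReal_iff' (negExp_ne_top _) (negExp_ne_top _)]
    exact fun h => hl (negExp_strictAnti.injective h)
  · intro g hg
    replace hg : g ∈ Submodule.span ℝ (Set.range F) := by
      have h1 : g ∈ Subalgebra.toSubmodule
          (Algebra.adjoin ℝ (S : Set (BoundedContinuousFunction (ι → ℝ≥0∞) ℝ))) := hg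
      rwa [Algebra.adjoin_eq_span, Submonoid.closure_eq] at h1
    clear * - hg h hF hcont
    induction hg using Submodule.span_induction with
    | mem x hx =>
      obtain ⟨k, rfl⟩ := hx
      simp_rw [hF]
      rw [integral_toReal (hcont k).measurable.aemeasurable (ae_of_all _ fun _ =>
          (negExp_ne_top _).lt_top), integral_toReal (hcont k).measurable.aemeasurable
          (ae_of_all _ fun _ => (negExp_ne_top _).lt_top), h k]
    | zero => simp
    | add x y _ _ hx hy =>
      have hi : ∀ (z : BoundedContinuousFunction (ι → ℝ≥0∞) ℝ) (m : Measure (ι → ℝ≥0∞))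
        [IsFiniteMeasure m], Integrable z m := fun z m _ => z.integrable m
      simp only [BoundedContinuousFunction.coe_add, Pi.add_apply]
      rw [integral_add (hi x μ) (hi y μ), integral_add (hi x ν) (hi y ν), hx, hy]
    | smul c x _ hx =>
      simp only [BoundedContinuousFunction.coe_smul, integral_smul, hx]

/-- Finite measures on `[0, ∞]` are determined by their Laplace transforms at natural arguments. -/
theorem measure_ext_of_lintegral_negExp
    {μ ν : Measure ℝ≥0∞} [IsFiniteMeasure μ] [IsFiniteMeasure ν]
    (h : ∀ k : ℕ, ∫⁻ x, negExp (k * x) ∂μ = ∫⁻ x, negExp (k * x) ∂ν) : μ = ν := by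
  let e := MeasurableEquiv.funUnique Unit ℝ≥0∞
  have key : μ.map e.symm = ν.map e.symm := by
    refine measure_pi_ext_of_lintegral_negExp fun k => ?_
    rw [lintegral_map_equiv, lintegral_map_equiv]
    simp only [Finset.univ_unique, Finset.sum_singleton]
    exact h _
  simpa [Measure.map_map e.measurable e.symm.measurable] using congrArg (Measure.map e) key

/-! ### From Poisson counts to the Laplace functional -/

/-- The family `T 0, T 1, …` has the Laplace functional of a Poisson point process with intensity
measure `μ`. -/
def HasPoissonLaplace {Ω E : Type*} [MeasurableSpace Ω] [MeasurableSpace E] (P : Measure Ω)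
    (T : ℕ → Ω → E) (μ : Measure E) : Prop :=
  ∀ φ : E → ℝ≥0∞, Measurable φ →
    ∫⁻ ω, negExp (∑' j, φ (T j ω)) ∂P = negExp (∫⁻ t, (1 - negExp (φ t)) ∂μ)

/-- The Poisson generating function `E q ^ n = exp (-r * (1 - q))` at `q = exp (-c)`; `c = ∞`
corresponds to `q = 0`. -/
lemma lintegral_negExp_poissonMeasure (r : NNReal) (c : ℝ≥0∞) :
    ∫⁻ n : ℕ, negExp (c * n) ∂poissonMeasure r = negExp (r * (1 - negExp c)) := by
  obtain ⟨q, hq⟩ : ∃ q : NNReal, negExp c = q := ⟨_, (ENNReal.coe_toNNReal (negExp_ne_top c)).symm⟩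
  have hq1 : q ≤ 1 := by exact_mod_cast hq ▸ negExp_le_one c
  have hq1' : (q : ℝ) ≤ 1 := by exact_mod_cast hq1
  have hterm : ∀ n : ℕ, negExp (c * n) * poissonMeasure r {n} =
      ENNReal.ofReal (Real.exp (-r) * ((q * r : ℝ) ^ n / n.factorial)) := by
    intro n
    rw [mul_comm c, negExp_nat_mul, hq, poissonMeasure_singleton,
      show (q : ℝ≥0∞) ^ n = ENNReal.ofReal ((q : ℝ) ^ n) by
        rw [ENNReal.ofReal_pow q.coe_nonneg]; simp,
      ← ENNReal.ofReal_mul (by positivity)]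
    congr 1
    ring
  have hsum := (NormedSpace.expSeries_div_hasSum_exp (𝔸 := ℝ) (q * r : ℝ)).mul_left (Real.exp (-r))
  rw [lintegral_countable']
  simp_rw [hterm]
  rw [← ENNReal.ofReal_tsum_of_nonneg (fun n => by positivity) hsum.summable, hsum.tsum_eq,
    ← Real.exp_eq_exp_ℝ, ← Real.exp_add]
  have h1 : (r : ℝ≥0∞) * (1 - negExp c) = ENNReal.ofReal (r * (1 - q)) := by
    rw [hq, ENNReal.ofReal_mul r.coe_nonneg, ENNReal.ofReal_sub _ q.coe_nonneg]; simp
  rw [h1, negExp_ofReal (mul_nonneg r.coe_nonneg (by linarith))]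
  congr 2
  ring

lemma measurableEmbedding_toENNReal : MeasurableEmbedding ENat.toENNReal :=
  ⟨ENat.toENNReal_strictMono.injective, measurable_of_countable _,
    fun s _ => (s.to_countable.image _).measurableSet⟩

lemma toENNReal_encard_eq_tsum (s : Set ℕ) : (s.encard : ℝ≥0∞) = ∑' i, s.indicator 1 i := by
  rw [← ENNReal.tsum_set_one, ← tsum_subtype]; rfl

lemma toENNReal_pointCount {Ω : Type*} (X : ℕ → Ω → Plane) (B : Set Plane) (ω : Ω) :
    (pointCount X B ω : ℝ≥0∞) = ∑' i, B.indicator 1 (X i ω) := by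
  rw [pointCount, toENNReal_encard_eq_tsum]; rfl

lemma measurable_pointCount {Ω : Type*} [MeasurableSpace Ω] {X : ℕ → Ω → Plane}
    (hX : ∀ i, Measurable (X i)) {B : Set Plane} (hB : MeasurableSet B) :
    Measurable (pointCount X B) := by
  rw [← measurableEmbedding_toENNReal.measurable_comp_iff]
  have : ENat.toENNReal ∘ pointCount X B = fun ω => ∑' i, B.indicator 1 (X i ω) :=
    funext fun ω => toENNReal_pointCount X B ω
  rw [this]
  exact Measurable.tsum fun i => (measurable_one.indicator hB).comp (hX i)

/-- The finite values already carry total mass one, so no mass is left for `⊤`. -/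
lemma map_eq_map_natCast {Ω : Type*} [MeasurableSpace Ω] {P : Measure Ω} [IsProbabilityMeasure P]
    {ν : Measure ℕ} [IsProbabilityMeasure ν] {N : Ω → ℕ∞} (hN : Measurable N)
    (h : ∀ k : ℕ, P {ω | N ω = k} = ν {k}) : P.map N = ν.map ((↑) : ℕ → ℕ∞) := by
  have hc : Measurable ((↑) : ℕ → ℕ∞) := measurable_of_countable _
  have : IsProbabilityMeasure (P.map N) := Measure.isProbabilityMeasure_map hN.aemeasurable
  have : IsProbabilityMeasure (ν.map ((↑) : ℕ → ℕ∞)) :=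
    Measure.isProbabilityMeasure_map hc.aemeasurable
  have hk : ∀ k : ℕ, P.map N {(k : ℕ∞)} = ν.map ((↑) : ℕ → ℕ∞) {(k : ℕ∞)} := by
    intro k
    rw [Measure.map_apply hN (measurableSet_singleton _),
      Measure.map_apply hc (measurableSet_singleton _)]
    have : ((↑) : ℕ → ℕ∞) ⁻¹' {(k : ℕ∞)} = {k} := by ext; simp
    rw [this, ← h k]
    rfl
  have htop : ({⊤} : Set ℕ∞) = (⋃ k : ℕ, {(k : ℕ∞)})ᶜ := by
    ext x
    cases x <;> simp
  have hdisj : Pairwise (Function.onFun Disjoint fun k : ℕ => ({(k : ℕ∞)} : Set ℕ∞)) := by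
    intro a b hab
    simpa [Function.onFun] using hab
  refine Measure.ext_of_singleton fun x => ?_
  induction x with
  | top =>
    rw [htop, prob_compl_eq_one_sub (.of_discrete), prob_compl_eq_one_sub (.of_discrete),
      measure_iUnion hdisj (fun _ => .of_discrete), measure_iUnion hdisj (fun _ => .of_discrete)]
    simp_rw [hk]
  | coe k => exact hk k

lemma IsHomogeneousPPP.lintegral_negExp_pointCount
    {Ω : Type*} [MeasurableSpace Ω] {P : Measure Ω} [IsProbabilityMeasure P]
    {X : ℕ → Ω → Plane} {lam : ℝ} (hlam : 0 ≤ lam)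
    (hX : IsHomogeneousPPP P X lam) {B : Set Plane} (hB : MeasurableSet B) (hB' : volume B < ⊤)
    (c : ℝ≥0∞) :
    ∫⁻ ω, negExp (c * pointCount X B ω) ∂P =
      negExp (ENNReal.ofReal lam * volume B * (1 - negExp c)) := by
  have hm := measurable_pointCount hX.measurable hB
  have hf : Measurable fun n : ℕ∞ => negExp (c * n) := measurable_of_countable _
  rw [← lintegral_map hf hm, map_eq_map_natCast hm (hX.poisson B hB hB'),
    lintegral_map hf (measurable_of_countable _)]
  simp_rw [ENat.toENNReal_coe]
  rw [lintegral_negExp_poissonMeasure]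
  congr 2
  change ENNReal.ofReal _ = _
  rw [ENNReal.ofReal_mul hlam, ENNReal.ofReal_toReal hB'.ne]

lemma IsHomogeneousPPP.iIndepFun_pointCount
    {Ω : Type*} [MeasurableSpace Ω] {P : Measure Ω}
    {X : ℕ → Ω → Plane} {lam : ℝ}
    (hX : IsHomogeneousPPP P X lam) {ι : Type*} [Fintype ι] {B : ι → Set Plane}
    (hB : ∀ l, MeasurableSet (B l)) (hB' : ∀ l, volume (B l) < ⊤)
    (hd : Pairwise (Function.onFun Disjoint B)) :
    iIndepFun (fun l => pointCount X (B l)) P := by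
  let e := Fintype.equivFin ι
  have := (hX.indep _ (fun l => B (e.symm l)) (fun _ => hB _) (fun _ => hB' _)
    (fun a b hab => hd (e.symm.injective.ne hab))).precomp e.injective
  simpa [Function.comp_def] using this

/-- Serves both `g = id` and `g c = 1 - negExp c`. Level `0` is left out so that only level sets
inside the support occur. -/
lemma MeasureTheory.SimpleFunc.apply_eq_sum_indicator {E : Type*} [MeasurableSpace E]
    (f : SimpleFunc E ℝ≥0∞) {g : ℝ≥0∞ → ℝ≥0∞} (hg : g 0 = 0) (x : E) :
    g (f x) = ∑ c : {c // c ∈ f.range.filter (· ≠ 0)},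
      g c * (f ⁻¹' {(c : ℝ≥0∞)}).indicator 1 x := by
  classical
  by_cases hx : f x = 0
  · rw [hx, hg, eq_comm]
    refine Finset.sum_eq_zero fun c _ => ?_
    have hc : (c : ℝ≥0∞) ≠ 0 := (Finset.mem_filter.1 c.2).2
    rw [Set.indicator_of_notMem, mul_zero]
    simpa [hx] using hc.symm
  · rw [Finset.sum_eq_single ⟨f x, Finset.mem_filter.2 ⟨f.mem_range_self x, hx⟩⟩]
    · simp
    · intro c _ hc
      rw [Set.indicator_of_notMem, mul_zero]
      intro h
      exact hc (Subtype.ext (by simpa using h.symm))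
    · simp

/-- The level sets are disjoint, so their counts are independent and the expectation factors into
Poisson transforms. -/
lemma IsHomogeneousPPP.laplace_simpleFunc
    {Ω : Type*} [MeasurableSpace Ω] {P : Measure Ω} [IsProbabilityMeasure P]
    {X : ℕ → Ω → Plane} {lam : ℝ} (hlam : 0 ≤ lam)
    (hX : IsHomogeneousPPP P X lam) (f : SimpleFunc Plane ℝ≥0∞)
    (hf : volume (Function.support f) < ⊤) :
    ∫⁻ ω, negExp (∑' j, f (X j ω)) ∂P =
      negExp (∫⁻ t, (1 - negExp (f t)) ∂(ENNReal.ofReal lam • volume)) := by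
  classical
  let s := f.range.filter (· ≠ 0)
  let B : s → Set Plane := fun c => f ⁻¹' {(c : ℝ≥0∞)}
  have hB : ∀ c, MeasurableSet (B c) := fun c => f.measurableSet_preimage _
  have hB' : ∀ c, volume (B c) < ⊤ := fun c => (measure_mono fun x hx => by
    have : f x = c := hx
    rw [Function.mem_support, this]
    exact (Finset.mem_filter.1 c.2).2).trans_lt hf
  have hd : Pairwise (Function.onFun Disjoint B) := fun a b hab =>
    Disjoint.preimage _ (by simpa using fun h => hab (Subtype.ext h))
  have h1 : ∀ ω, ∑' j, f (X j ω) = ∑ c : s, (c : ℝ≥0∞) * pointCount X (B c) ω := by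
    intro ω
    simp_rw [toENNReal_pointCount, ← ENNReal.tsum_mul_left]
    rw [← Summable.tsum_finsetSum fun _ _ => ENNReal.summable]
    exact tsum_congr fun j => f.apply_eq_sum_indicator (g := id) rfl _
  have h2 : ∀ t, 1 - negExp (f t) = ∑ c : s, (1 - negExp c) * (B c).indicator 1 t := fun t =>
    f.apply_eq_sum_indicator (g := fun c => 1 - negExp c) (by simp) t
  simp_rw [h1, h2, negExp_sum]
  rw [lintegral_finsetSum _ fun c _ => by
    exact ((measurable_one.indicator (hB c)).const_mul _), negExp_sum]
  have hind := (hX.iIndepFun_pointCount hB hB' hd).comp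
    (fun c n => negExp ((c : ℝ≥0∞) * (n : ℕ∞))) (fun _ => measurable_of_countable _)
  have := lintegral_prod_eq_prod_lintegral_of_indepFun Finset.univ _ hind fun c =>
    (measurable_of_countable _).comp (measurable_pointCount hX.measurable (hB c))
  simp only [Function.comp_apply] at this
  rw [this]
  refine Finset.prod_congr rfl fun c _ => ?_
  rw [hX.lintegral_negExp_pointCount hlam (hB c) (hB' c),
    lintegral_const_mul _ (measurable_one.indicator (hB c)), lintegral_indicator_one (hB c)]
  simp [mul_comm]

/-- Approximate `φ` from below by simple functions cut off to sets of finite area. The expectations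
converge by domination by `1`, the exponents by monotone convergence. -/
theorem IsHomogeneousPPP.hasPoissonLaplace
    {Ω : Type*} [MeasurableSpace Ω] {P : Measure Ω} [IsProbabilityMeasure P]
    {X : ℕ → Ω → Plane} {lam : ℝ} (hlam : 0 ≤ lam)
    (hX : IsHomogeneousPPP P X lam) : HasPoissonLaplace P X (ENNReal.ofReal lam • volume) := by
  intro φ hφ
  let f : ℕ → SimpleFunc Plane ℝ≥0∞ := fun n =>
    (SimpleFunc.eapprox φ n).restrict (spanningSets volume n)
  have hfval : ∀ n t, f n t = (spanningSets (volume : Measure Plane) n).indicator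
      (SimpleFunc.eapprox φ n) t := fun n t =>
    by rw [SimpleFunc.restrict_apply _ (measurableSet_spanningSets _ _)]
  have hfsupp : ∀ n, volume (Function.support (f n)) < ⊤ := fun n =>
    (measure_mono fun x hx => by
      by_contra h
      exact hx (by rw [hfval, Set.indicator_of_notMem h])).trans_lt
      (measure_spanningSets_lt_top (volume : Measure Plane) n)
  have hmono : ∀ t, Monotone fun n => f n t := by
    intro t m n hmn
    simp only [hfval]
    calc _ ≤ (spanningSets (volume : Measure Plane) n).indicator (SimpleFunc.eapprox φ m) t :=
          Set.indicator_le_indicator_of_subset (monotone_spanningSets _ hmn) (fun _ => zero_le) _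
      _ ≤ _ := Set.indicator_le_indicator (SimpleFunc.monotone_eapprox φ hmn t)
  have hsup : ∀ t, ⨆ n, f n t = φ t := by
    intro t
    obtain ⟨n, hn⟩ : ∃ n, t ∈ spanningSets (volume : Measure Plane) n := by
      rw [← Set.mem_iUnion, iUnion_spanningSets]
      exact Set.mem_univ t
    refine le_antisymm (iSup_le fun k => ?_) ?_
    · rw [hfval, ← SimpleFunc.iSup_eapprox_apply hφ t]
      exact (Set.indicator_le_self _ _ _).trans (le_iSup (fun k => SimpleFunc.eapprox φ k t) k)
    · rw [← SimpleFunc.iSup_eapprox_apply hφ t]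
      refine iSup_le fun k => le_iSup_of_le (max k n) ?_
      rw [hfval, Set.indicator_of_mem (monotone_spanningSets _ (le_max_right k n) hn)]
      exact SimpleFunc.monotone_eapprox φ (le_max_left k n) t
  have hL : Tendsto (fun n => ∫⁻ ω, negExp (∑' j, f n (X j ω)) ∂P) atTop
      (𝓝 (∫⁻ ω, negExp (∑' j, φ (X j ω)) ∂P)) := by
    refine tendsto_lintegral_of_dominated_convergence (fun _ => 1) (fun n => ?_)
      (fun n => ae_of_all _ fun ω => negExp_le_one _) (by simp) (ae_of_all _ fun ω => ?_)
    · exact measurable_negExp.comp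
        (Measurable.tsum fun j => (f n).measurable.comp (hX.measurable j))
    · refine (continuous_negExp.tendsto _).comp ?_
      have : ∑' j, φ (X j ω) = ⨆ n, ∑' j, f n (X j ω) := by
        simp_rw [← hsup, ← lintegral_count]
        exact lintegral_iSup (fun n => measurable_of_countable _) fun m n hmn j => hmono _ hmn
      rw [this]
      exact tendsto_atTop_iSup fun m n hmn => ENNReal.tsum_le_tsum fun j => hmono _ hmn
  have hR : Tendsto (fun n => negExp (∫⁻ t, (1 - negExp (f n t)) ∂(ENNReal.ofReal lam • volume)))
      atTop (𝓝 (negExp (∫⁻ t, (1 - negExp (φ t)) ∂(ENNReal.ofReal lam • volume)))) := by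
    refine (continuous_negExp.tendsto _).comp ?_
    refine lintegral_tendsto_of_tendsto_of_monotone (fun n => ?_)
      (ae_of_all _ fun t m n hmn => one_sub_negExp_mono (hmono t hmn)) (ae_of_all _ fun t => ?_)
    · exact (measurable_const.sub (measurable_negExp.comp (f n).measurable)).aemeasurable
    · refine ENNReal.Tendsto.sub tendsto_const_nhds ((continuous_negExp.tendsto _).comp ?_)
        (Or.inl (by simp))
      rw [← hsup]
      exact tendsto_atTop_iSup (hmono t)
  refine tendsto_nhds_unique hL (hR.congr fun n => ?_)
  exact (hX.laplace_simpleFunc hlam (f n) (hfsupp n)).symm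

/-! ### From the Laplace functional back to Poisson counts -/

lemma HasPoissonLaplace.map_pointCount {Ω : Type*} [MeasurableSpace Ω] {P : Measure Ω}
    [IsProbabilityMeasure P] {T : ℕ → Ω → Plane} {lam : ℝ}
    (hlam : 0 ≤ lam) (hT : ∀ i, Measurable (T i))
    (h : HasPoissonLaplace P T (ENNReal.ofReal lam • volume)) {ι : Type*} [Fintype ι]
    {B : ι → Set Plane} (hB : ∀ l, MeasurableSet (B l)) (hB' : ∀ l, volume (B l) < ⊤)
    (hd : Pairwise (Function.onFun Disjoint B)) :
    P.map (fun ω l => (pointCount T (B l) ω : ℝ≥0∞)) =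
      Measure.pi fun l => (poissonMeasure (Real.toNNReal (lam * (volume (B l)).toReal))).map
        fun n : ℕ => (n : ℝ≥0∞) := by
  classical
  have hc : Measurable fun n : ℕ => (n : ℝ≥0∞) := measurable_of_countable _
  have (l : ι) : IsProbabilityMeasure ((poissonMeasure (Real.toNNReal
      (lam * (volume (B l)).toReal))).map fun n : ℕ => (n : ℝ≥0∞)) :=
    Measure.isProbabilityMeasure_map hc.aemeasurable
  have hN : Measurable fun ω l => (pointCount T (B l) ω : ℝ≥0∞) := measurable_pi_lambda _ fun l =>
    measurableEmbedding_toENNReal.measurable.comp (measurable_pointCount hT (hB l))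
  have : IsProbabilityMeasure (P.map fun ω l => (pointCount T (B l) ω : ℝ≥0∞)) :=
    Measure.isProbabilityMeasure_map hN.aemeasurable
  refine measure_pi_ext_of_lintegral_negExp fun k => ?_
  have hm : ∀ l, Measurable fun x : ℝ≥0∞ => negExp (k l * x) := fun l =>
    measurable_negExp.comp (measurable_id.const_mul _)
  have hmk : Measurable fun x : ι → ℝ≥0∞ => negExp (∑ l, k l * x l) :=
    measurable_negExp.comp (Finset.measurable_fun_sum _ fun l _ =>
      (measurable_pi_apply l).const_mul _)
  rw [lintegral_map hmk hN]
  have hφ : ∀ ω, ∑ l, (k l : ℝ≥0∞) * pointCount T (B l) ω =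
      ∑' j, ∑ l, (k l : ℝ≥0∞) * (B l).indicator 1 (T j ω) := by
    intro ω
    simp_rw [toENNReal_pointCount, ← ENNReal.tsum_mul_left]
    rw [Summable.tsum_finsetSum fun _ _ => ENNReal.summable]
  -- By disjointness at most one indicator is nonzero at `t`, so `1 - exp (-·)` is additive here;
  -- this is what produces independence.
  have hsplit : ∀ t, 1 - negExp (∑ l, (k l : ℝ≥0∞) * (B l).indicator 1 t) =
      ∑ l, (1 - negExp (k l)) * (B l).indicator 1 t := by
    intro t
    by_cases ht : ∃ m, t ∈ B m
    · obtain ⟨m, hm⟩ := ht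
      have hne : ∀ l, l ≠ m → t ∉ B l := fun l hl hlt => (hd hl).le_bot ⟨hlt, hm⟩
      rw [Finset.sum_eq_single m, Finset.sum_eq_single m]
      · simp [hm]
      all_goals simp +contextual [hne]
    · push Not at ht
      simp [ht]
  simp_rw [hφ]
  rw [h _ (Finset.measurable_fun_sum _ fun l _ => (measurable_one.indicator (hB l)).const_mul _)]
  simp_rw [hsplit]
  rw [lintegral_finsetSum _ fun l _ => by
    exact ((measurable_one.indicator (hB l)).const_mul _)]
  simp_rw [negExp_sum]
  have hind := iIndepFun_pi (μ := fun l => (poissonMeasure (Real.toNNReal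
      (lam * (volume (B l)).toReal))).map fun n : ℕ => (n : ℝ≥0∞))
      (X := fun l x => negExp (k l * x)) fun l => (hm l).aemeasurable
  have := lintegral_prod_eq_prod_lintegral_of_indepFun Finset.univ _ hind fun l =>
    (hm l).comp (measurable_pi_apply l)
  rw [this]
  refine Finset.prod_congr rfl fun l _ => ?_
  rw [← lintegral_map (hm l) (measurable_pi_apply l), (measurePreserving_eval _ l).map_eq,
    lintegral_map (hm l) hc, lintegral_negExp_poissonMeasure,
    lintegral_const_mul _ (measurable_one.indicator (hB l)), lintegral_indicator_one (hB l),
    mul_comm]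
  congr 2
  change _ = ENNReal.ofReal _
  rw [ENNReal.ofReal_mul hlam, ENNReal.ofReal_toReal (hB' l).ne]
  rfl

theorem HasPoissonLaplace.isHomogeneousPPP {Ω : Type*} [MeasurableSpace Ω] {P : Measure Ω}
    [IsProbabilityMeasure P] {T : ℕ → Ω → Plane} {lam : ℝ}
    (hlam : 0 ≤ lam) (hT : ∀ i, Measurable (T i))
    (h : HasPoissonLaplace P T (ENNReal.ofReal lam • volume)) : IsHomogeneousPPP P T lam := by
  have hc : Measurable fun n : ℕ => (n : ℝ≥0∞) := measurable_of_countable _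
  have hprob (r : NNReal) : IsProbabilityMeasure ((poissonMeasure r).map fun n : ℕ => (n : ℝ≥0∞)) :=
    Measure.isProbabilityMeasure_map hc.aemeasurable
  have hN {B : Set Plane} (hB : MeasurableSet B) :
      Measurable fun ω => (pointCount T B ω : ℝ≥0∞) :=
    measurableEmbedding_toENNReal.measurable.comp (measurable_pointCount hT hB)
  have hlaw : ∀ B : Set Plane, MeasurableSet B → volume B < ⊤ →
      P.map (fun ω => (pointCount T B ω : ℝ≥0∞)) =
      (poissonMeasure (Real.toNNReal (lam * (volume B).toReal))).map fun n : ℕ => (n : ℝ≥0∞) := by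
    intro B hB hB'
    -- A single set is the joint law for a one-element index type.
    have := congrArg (Measure.map fun x : Unit → ℝ≥0∞ => x ()) (h.map_pointCount hlam hT
      (ι := Unit) (B := fun _ => B) (fun _ => hB) (fun _ => hB')
      (fun a b hab => (hab rfl).elim))
    rw [(measurePreserving_eval _ ()).map_eq, Measure.map_map (measurable_pi_apply _)
      (measurable_pi_lambda _ fun _ => hN hB)] at this
    exact this
  refine ⟨hT, fun B hB hB' k => ?_, fun n B hB hB' hd => ?_⟩
  · have := congrArg (fun m => m {(k : ℝ≥0∞)}) (hlaw B hB hB')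
    rw [Measure.map_apply (hN hB) (measurableSet_singleton _),
      Measure.map_apply hc (measurableSet_singleton _)] at this
    convert this using 2
    · ext ω
      simp only [Set.mem_ofPred_eq, Set.mem_preimage, Set.mem_singleton_iff]
      rw [← ENat.toENNReal_coe, ENat.toENNReal_inj]
    · ext; simp
  · have hind : iIndepFun (fun l ω => (pointCount T (B l) ω : ℝ≥0∞)) P := by
      rw [iIndepFun_iff_map_fun_eq_pi_map fun l => (hN (hB l)).aemeasurable,
        h.map_pointCount hlam hT hB hB' hd]
      congr 1
      funext l
      exact (hlaw _ (hB l) (hB' l)).symm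
    have := hind.comp (fun _ => measurableEmbedding_toENNReal.invFun)
      fun _ => measurableEmbedding_toENNReal.measurable_invFun
    convert this using 2 with l
    funext ω
    exact (measurableEmbedding_toENNReal.leftInverse_invFun _).symm

/-! ### Marking and mapping -/

/-- Independent marking of a Poisson process: if the marks are i.i.d. with law `Q` and independent
of the points, then the marked points have intensity `μ.prod Q`. -/
theorem HasPoissonLaplace.prodMk {Ω E F : Type*} [MeasurableSpace Ω] [MeasurableSpace E]
    [MeasurableSpace F] {P : Measure Ω} [IsProbabilityMeasure P] {X : ℕ → Ω → E} {m : ℕ → Ω → F}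
    {μ : Measure E} [SFinite μ] {Q : Measure F} [IsProbabilityMeasure Q]
    (h : HasPoissonLaplace P X μ) (hX : ∀ i, Measurable (X i)) (hm : ∀ i, Measurable (m i))
    (hQ : ∀ i, P.map (m i) = Q) (hind : iIndepFun m P)
    (hXm : IndepFun (fun ω i => X i ω) (fun ω i => m i ω) P) :
    HasPoissonLaplace P (fun i ω => (X i ω, m i ω)) (μ.prod Q) := by
  intro φ hφ
  have hφe : Measurable fun p => negExp (φ p) := measurable_negExp.comp hφ
  -- Averaging over the marks with the locations frozen replaces `negExp (φ (x, ·))` by `u x`. The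
  -- product of the `u (X j)` is again an exponential of a sum, with test function `negLog ∘ u`, to
  -- which `h` applies.
  let u : E → ℝ≥0∞ := fun x => ∫⁻ y, negExp (φ (x, y)) ∂Q
  have hu : Measurable u := hφe.lintegral_prod_right'
  have hu1 : ∀ x, u x ≤ 1 := fun x =>
    (lintegral_mono fun y => negExp_le_one _).trans (by simp)
  have hXs : Measurable fun ω i => X i ω := measurable_pi_lambda _ hX
  have hms : Measurable fun ω i => m i ω := measurable_pi_lambda _ hm
  -- Independence of the marks factors finite products only; the infinite product follows by
  -- dominated convergence.
  have hfin : ∀ n, ∫⁻ ω, ∏ j ∈ Finset.range n, negExp (φ (X j ω, m j ω)) ∂P =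
      ∫⁻ ω, ∏ j ∈ Finset.range n, u (X j ω) ∂P := by
    intro n
    have hg : Measurable fun p : (ℕ → E) × (ℕ → F) =>
        ∏ j ∈ Finset.range n, negExp (φ (p.1 j, p.2 j)) :=
      Finset.measurable_fun_prod _ fun j _ => hφe.comp
        (((measurable_pi_apply j).comp measurable_fst).prodMk
          ((measurable_pi_apply j).comp measurable_snd))
    have hjoint := (indepFun_iff_map_prod_eq_prod_map_map hXs.aemeasurable hms.aemeasurable).1 hXm
    have h1 : ∫⁻ ω, ∏ j ∈ Finset.range n, negExp (φ (X j ω, m j ω)) ∂P =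
        ∫⁻ p, ∏ j ∈ Finset.range n, negExp (φ (p.1 j, p.2 j))
          ∂(P.map fun ω => ((fun i => X i ω), fun i => m i ω)) :=
      (lintegral_map hg (hXs.prodMk hms)).symm
    have hgu : Measurable fun x : ℕ → E => ∏ j ∈ Finset.range n, u (x j) :=
      Finset.measurable_fun_prod _ fun j _ => hu.comp (measurable_pi_apply j)
    have h2 : ∫⁻ ω, ∏ j ∈ Finset.range n, u (X j ω) ∂P =
        ∫⁻ x, ∏ j ∈ Finset.range n, u (x j) ∂(P.map fun ω i => X i ω) :=
      (lintegral_map hgu hXs).symm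
    rw [h1, h2, hjoint, lintegral_prod _ hg.aemeasurable]
    refine lintegral_congr fun x => ?_
    have hgx : Measurable fun y : ℕ → F => ∏ j ∈ Finset.range n, negExp (φ (x j, y j)) :=
      hg.comp measurable_prodMk_left
    rw [lintegral_map hgx hms]
    have hφx : ∀ j, Measurable fun y => negExp (φ (x j, y)) := fun j =>
      hφe.comp measurable_prodMk_left
    rw [lintegral_prod_eq_prod_lintegral_of_indepFun (Finset.range n)
      (fun j ω => negExp (φ (x j, m j ω))) (hind.comp (fun j y => negExp (φ (x j, y))) hφx)
      fun j => (hφx j).comp (hm j)]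
    refine Finset.prod_congr rfl fun j _ => ?_
    rw [← lintegral_map (hφx j) (hm j), hQ]
  have hprod1 : ∀ n (a : ℕ → ℝ≥0∞), (∀ j, a j ≤ 1) → ∏ j ∈ Finset.range n, a j ≤ 1 :=
    fun n a ha => Finset.prod_le_one' fun j _ => ha j
  have hL : Tendsto (fun n => ∫⁻ ω, ∏ j ∈ Finset.range n, negExp (φ (X j ω, m j ω)) ∂P) atTop
      (𝓝 (∫⁻ ω, negExp (∑' j, φ (X j ω, m j ω)) ∂P)) :=
    tendsto_lintegral_of_dominated_convergence (fun _ => 1)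
      (fun n => Finset.measurable_fun_prod _ fun j _ => hφe.comp ((hX j).prodMk (hm j)))
      (fun n => ae_of_all _ fun ω => hprod1 _ _ fun j => negExp_le_one _) (by simp)
      (ae_of_all _ fun ω => tendsto_prod_negExp _)
  have hR : Tendsto (fun n => ∫⁻ ω, ∏ j ∈ Finset.range n, u (X j ω) ∂P) atTop
      (𝓝 (∫⁻ ω, negExp (∑' j, negLog (u (X j ω))) ∂P)) := by
    refine tendsto_lintegral_of_dominated_convergence (fun _ => 1)
      (fun n => Finset.measurable_fun_prod _ fun j _ => hu.comp (hX j))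
      (fun n => ae_of_all _ fun ω => hprod1 _ _ fun j => hu1 _) (by simp)
      (ae_of_all _ fun ω => ?_)
    refine (tendsto_prod_negExp _).congr fun n => Finset.prod_congr rfl fun j _ => ?_
    exact negExp_negLog (hu1 _)
  simp_rw [hfin] at hL
  have hsub : Measurable fun p => 1 - negExp (φ p) := measurable_const.sub hφe
  have hXu := h (fun x => negLog (u x)) (measurable_negLog.comp hu)
  rw [tendsto_nhds_unique hL hR, hXu, lintegral_prod _ hsub.aemeasurable]
  congr 1
  refine lintegral_congr fun x => ?_
  have hx : Measurable fun y => negExp (φ (x, y)) := hφe.comp measurable_prodMk_left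
  rw [negExp_negLog (hu1 x), lintegral_sub hx
    ((hu1 x).trans_lt ENNReal.one_lt_top).ne (ae_of_all _ fun y => negExp_le_one _)]
  simp [u]

lemma HasPoissonLaplace.map {Ω E F : Type*} [MeasurableSpace Ω] [MeasurableSpace E]
    [MeasurableSpace F] {P : Measure Ω} {T : ℕ → Ω → E} {μ : Measure E}
    (h : HasPoissonLaplace P T μ) {G : E → F} (hG : Measurable G) :
    HasPoissonLaplace P (fun i ω => G (T i ω)) (μ.map G) := by
  intro φ hφ
  have hsub : Measurable fun p => 1 - negExp (φ p) :=
    measurable_const.sub (measurable_negExp.comp hφ)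
  rw [lintegral_map hsub hG]
  exact h _ (hφ.comp hG)

/-! ### Displacement by the shadowing -/

lemma lintegral_plane_smul {a : ℝ} (ha : 0 < a) {f : Plane → ℝ≥0∞} (hf : Measurable f) :
    ∫⁻ x, f (a • x) = ENNReal.ofReal (a ^ 2)⁻¹ * ∫⁻ x, f x := by
  rw [← lintegral_map hf (measurable_const_smul a), Measure.map_addHaar_smul _ ha.ne',
    lintegral_smul_measure, abs_of_pos (by positivity)]
  simp

namespace HelloNetwork

/-- Marks without the shadowing gain. -/
abbrev ReducedMark (M : ℕ) : Type := (ℝ × ℝ) × Bool × Fin M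

/-- The displaced location of a node, scaled by `c`, as a function of its location and mark. -/
noncomputable def reduce (α c : ℝ) {M : ℕ} (p : Plane × ((ℝ × ℝ) × ℝ × Bool × Fin M)) :
    Plane × ReducedMark M :=
  (c • (p.2.2.1 ^ (-1 / α)) • p.1, p.2.1, p.2.2.2)

lemma measurable_reduce (α c : ℝ) {M : ℕ} : Measurable (reduce α c (M := M)) := by
  unfold reduce
  fun_prop

/-- The law of the reduced marks. -/
noncomputable def reducedLaw (M : ℕ) (ρ : ℝ) (κ : Measure (ℝ × ℝ)) : Measure (ReducedMark M) :=
  κ.prod ((transmitLaw ρ).prod (uniformOn (Set.univ : Set (Fin M))))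

lemma isProbabilityMeasure_transmitLaw {ρ : ℝ} (hρ0 : 0 ≤ ρ) (hρ1 : ρ ≤ 1) :
    IsProbabilityMeasure (transmitLaw ρ) := by
  constructor
  simp only [transmitLaw, Measure.coe_add, Measure.coe_smul, Pi.add_apply, Pi.smul_apply,
    measure_univ, smul_eq_mul, mul_one]
  rw [← ENNReal.ofReal_add hρ0 (by linarith)]
  simp

/-- For a fixed mark, `x ↦ c • θ ^ (-1 / α) • x` multiplies Lebesgue measure by `c⁻² * θ ^ (2 / α)`.
The factor depends on `θ` alone, which is independent of the other marks, so integrating `θ` out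
leaves their law unchanged. -/
theorem map_reduce {α c : ℝ} (hc : 0 < c) {M : ℕ} {lam : ℝ} (hlam : 0 ≤ lam)
    {κ : Measure (ℝ × ℝ)} [SFinite κ] {ν : Measure ℝ} (hν : IsShadowingLaw α ν)
    {R : Measure (Bool × Fin M)} [SFinite R] :
    ((ENNReal.ofReal lam • (volume : Measure Plane)).prod (κ.prod (ν.prod R))).map (reduce α c) =
      ENNReal.ofReal (lam * (c ^ 2)⁻¹ * ∫ t, t ^ (2 / α) ∂ν) •
        (volume : Measure Plane).prod (κ.prod R) := by
  have := hν.prob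
  refine Measure.ext_of_lintegral _ fun f hf => ?_
  have hfr : Measurable fun p => f (reduce α c p) := hf.comp (measurable_reduce α c)
  rw [lintegral_map hf (measurable_reduce α c), lintegral_prod_symm _ hfr.aemeasurable,
    lintegral_smul_measure, lintegral_prod_symm _ hf.aemeasurable]
  have hθ : ∀ᵐ p : (ℝ × ℝ) × ℝ × Bool × Fin M ∂κ.prod (ν.prod R), 0 < p.2.1 := by
    have h1 : ∀ᵐ q : ℝ × Bool × Fin M ∂ν.prod R, 0 < q.1 :=
      Measure.quasiMeasurePreserving_fst.ae hν.pos
    exact Measure.quasiMeasurePreserving_snd.ae h1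
  have hF : Measurable fun q : ReducedMark M => ∫⁻ x : Plane, f (x, q) :=
    hf.lintegral_prod_left'
  have hin : ∀ᵐ p : (ℝ × ℝ) × ℝ × Bool × Fin M ∂κ.prod (ν.prod R),
      ∫⁻ x, f (reduce α c (x, p)) ∂(ENNReal.ofReal lam • (volume : Measure Plane)) =
        ENNReal.ofReal (lam * (c ^ 2)⁻¹) * (ENNReal.ofReal (p.2.1 ^ (2 / α)) *
          (∫⁻ x : Plane, f (x, p.1, p.2.2))) := by
    filter_upwards [hθ] with p hp
    have hpos : 0 < c * p.2.1 ^ (-1 / α) := mul_pos hc (Real.rpow_pos_of_pos hp _)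
    simp only [reduce, smul_smul]
    rw [lintegral_smul_measure, lintegral_plane_smul hpos
      (f := fun x => f (x, p.1, p.2.2)) (hf.comp measurable_prodMk_right), smul_eq_mul,
      ← mul_assoc, ← mul_assoc, ← ENNReal.ofReal_mul hlam,
      ← ENNReal.ofReal_mul (by positivity)]
    congr 2
    rw [mul_pow, mul_inv, ← Real.rpow_natCast (p.2.1 ^ (-1 / α)), ← Real.rpow_mul hp.le,
      ← Real.rpow_neg hp.le, ← mul_assoc]
    congr 2
    push_cast
    ring
  rw [lintegral_congr_ae hin, lintegral_const_mul']
  swap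
  · simp
  have hA : Measurable fun t : ℝ => ENNReal.ofReal (t ^ (2 / α)) := by fun_prop
  rw [lintegral_prod _ (by
    refine Measurable.aemeasurable (.mul (hA.comp (by fun_prop)) (hF.comp (by fun_prop))))]
  have hmom : ∫⁻ t, ENNReal.ofReal (t ^ (2 / α)) ∂ν = ENNReal.ofReal (∫ t, t ^ (2 / α) ∂ν) := by
    rw [ofReal_integral_eq_lintegral_ofReal hν.moment]
    filter_upwards [hν.pos] with t ht using Real.rpow_nonneg ht.le _
  have hinner : ∀ q : ℝ × ℝ, ∫⁻ y : ℝ × Bool × Fin M, ENNReal.ofReal (y.1 ^ (2 / α)) *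
      (∫⁻ x : Plane, f (x, q, y.2)) ∂ν.prod R =
      ENNReal.ofReal (∫ t, t ^ (2 / α) ∂ν) * lintegral R fun r => ∫⁻ x : Plane, f (x, q, r) := by
    intro q
    have hFq : Measurable fun r => ∫⁻ x : Plane, f (x, q, r) := hF.comp measurable_prodMk_left
    rw [lintegral_prod_mul hA.aemeasurable hFq.aemeasurable, hmom]
  simp_rw [hinner]
  rw [lintegral_const_mul' _ _ (by simp), ← mul_assoc, ← ENNReal.ofReal_mul (by positivity),
    lintegral_prod _ hF.aemeasurable, smul_eq_mul]

end HelloNetwork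

/-! ### The Mecke formula -/

lemma negExp_mul_one_sub (x y : ℝ≥0∞) :
    negExp x * (1 - negExp y) = negExp x - negExp (x + y) := by
  rw [negExp_add, ENNReal.mul_sub (fun _ _ => negExp_ne_top x), mul_one]

/-- The sum of `φ` over all points but the `i`-th. -/
noncomputable def sumOthers {Ω E : Type*} (T : ℕ → Ω → E) (φ : E → ℝ≥0∞) (i : ℕ) (ω : Ω) : ℝ≥0∞ :=
  ∑' j, if j = i then 0 else φ (T j ω)

section

variable {Ω E : Type*} [MeasurableSpace Ω] [MeasurableSpace E] {P : Measure Ω}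
  {T : ℕ → Ω → E} {μ : Measure E}

/-- The Mecke formula, for exponential functionals. -/
theorem HasPoissonLaplace.lintegral_tsum_mul_negExp (h : HasPoissonLaplace P T μ)
    (hT : ∀ i, Measurable (T i)) {f φ : E → ℝ≥0∞} (hf : Measurable f) (hφ : Measurable φ) :
    ∫⁻ ω, (∑' i, f (T i ω)) * negExp (∑' j, φ (T j ω)) ∂P =
      negExp (∫⁻ t, (1 - negExp (φ t)) ∂μ) * ∫⁻ t, f t * negExp (φ t) ∂μ := by
  have hmT : ∀ {g : E → ℝ≥0∞}, Measurable g → Measurable fun ω => ∑' i, g (T i ω) :=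
    fun hg => Measurable.tsum fun i => hg.comp (hT i)
  have hfk : ∀ k : ℕ, Measurable fun t => f t / 2 ^ k := fun k => hf.div_const _
  have hef : ∀ k : ℕ, Measurable fun t => 1 - negExp (f t / 2 ^ k) := fun k =>
    measurable_const.sub (measurable_negExp.comp (hfk k))
  have heφ : Measurable fun t => negExp (φ t) := measurable_negExp.comp hφ
  have hφ1 : Measurable fun t => 1 - negExp (φ t) := measurable_const.sub heφ
  let A := ∫⁻ t, (1 - negExp (φ t)) ∂μ
  -- The Laplace functional is differentiated at `φ` in the direction `f`: the quotient with step
  -- `2⁻ᵏ` is the difference of its values at `φ` and `φ + f / 2 ^ k`, and `y k` is the matching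
  -- quotient in the exponent.
  let y : ℕ → ℝ≥0∞ := fun k => ∫⁻ t, 2 ^ k * (1 - negExp (f t / 2 ^ k)) * negExp (φ t) ∂μ
  have hstep : ∀ k : ℕ, ∫⁻ ω, 2 ^ k * (1 - negExp ((∑' i, f (T i ω)) / 2 ^ k)) *
      negExp (∑' j, φ (T j ω)) ∂P = negExp A * (2 ^ k * (1 - negExp (y k / 2 ^ k))) := by
    intro k
    have hyk : y k / 2 ^ k = ∫⁻ t, negExp (φ t) * (1 - negExp (f t / 2 ^ k)) ∂μ := by
      have : ∀ t, 2 ^ k * (1 - negExp (f t / 2 ^ k)) * negExp (φ t) =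
          2 ^ k * (negExp (φ t) * (1 - negExp (f t / 2 ^ k))) := fun t => by ring
      simp only [y, this]
      rw [lintegral_const_mul' _ _ (by simp), mul_comm, ENNReal.mul_div_cancel_right (by simp)
        (by simp)]
    have hsum : ∀ ω, ∑' j, φ (T j ω) + (∑' i, f (T i ω)) / 2 ^ k =
        ∑' j, (φ (T j ω) + f (T j ω) / 2 ^ k) := by
      intro ω
      rw [ENNReal.tsum_add, div_eq_mul_inv, ← ENNReal.tsum_mul_right]
      simp_rw [div_eq_mul_inv]
    have hD : ∫⁻ t, (1 - negExp (φ t + f t / 2 ^ k)) ∂μ = A + y k / 2 ^ k := by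
      simp_rw [one_sub_negExp_add]
      rw [lintegral_add_left hφ1, hyk]
    have hint : ∀ ω, 2 ^ k * (1 - negExp ((∑' i, f (T i ω)) / 2 ^ k)) *
      negExp (∑' j, φ (T j ω)) = 2 ^ k * (negExp (∑' j, φ (T j ω)) -
        negExp (∑' j, (φ (T j ω) + f (T j ω) / 2 ^ k))) := by
      intro ω
      rw [← hsum, ← negExp_mul_one_sub]
      ring
    simp_rw [hint]
    have hle : ∀ ω, negExp (∑' j, (φ (T j ω) + f (T j ω) / 2 ^ k)) ≤ negExp (∑' j, φ (T j ω)) :=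
      fun ω => negExp_strictAnti.antitone (ENNReal.tsum_le_tsum fun j => le_self_add)
    have hh := h _ (hφ.add (hfk k))
    have hmk : Measurable fun ω => negExp (∑' j, (φ (T j ω) + f (T j ω) / 2 ^ k)) :=
      measurable_negExp.comp (hmT (hφ.add (hfk k)))
    simp only [Pi.add_apply] at hh
    rw [lintegral_const_mul' _ _ (by simp), lintegral_sub hmk _ (ae_of_all _ hle), h _ hφ, hh, hD,
      mul_left_comm, negExp_mul_one_sub]
    rw [hh]
    exact negExp_ne_top _
  have hy : Monotone y := fun m n hmn => lintegral_mono fun t => by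
    have := monotone_two_pow_mul_one_sub_negExp (f t) hmn
    dsimp only at this ⊢
    gcongr
  have hysup : ⨆ k, y k = ∫⁻ t, f t * negExp (φ t) ∂μ := by
    have hmk : ∀ k : ℕ, Measurable fun t => 2 ^ k * (1 - negExp (f t / 2 ^ k)) * negExp (φ t) :=
      fun k => ((hef k).const_mul _).mul heφ
    rw [← lintegral_iSup hmk fun m n hmn t => mul_le_mul_left
      (monotone_two_pow_mul_one_sub_negExp (f t) hmn) _]
    simp_rw [← ENNReal.iSup_mul, iSup_two_pow_mul_one_sub_negExp]
  calc ∫⁻ ω, (∑' i, f (T i ω)) * negExp (∑' j, φ (T j ω)) ∂P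
      = ∫⁻ ω, ⨆ k : ℕ, 2 ^ k * (1 - negExp ((∑' i, f (T i ω)) / 2 ^ k)) *
          negExp (∑' j, φ (T j ω)) ∂P := by
        simp_rw [← ENNReal.iSup_mul, iSup_two_pow_mul_one_sub_negExp]
    _ = ⨆ k : ℕ, negExp A * (2 ^ k * (1 - negExp (y k / 2 ^ k))) := by
        rw [lintegral_iSup]
        · simp_rw [hstep]
        · exact fun k => ((measurable_const.sub (measurable_negExp.comp
            ((hmT hf).div_const _))).const_mul _).mul (measurable_negExp.comp (hmT hφ))
        · intro m n hmn ω
          have := monotone_two_pow_mul_one_sub_negExp (∑' i, f (T i ω)) hmn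
          dsimp only at this ⊢
          gcongr
    _ = _ := by
        rw [← ENNReal.mul_iSup, iSup_two_pow_mul_one_sub_negExp_diag hy, hysup]

/-- Campbell's formula. -/
lemma HasPoissonLaplace.campbell (h : HasPoissonLaplace P T μ)
    (hT : ∀ i, Measurable (T i)) {f : E → ℝ≥0∞} (hf : Measurable f) :
    ∫⁻ ω, ∑' i, f (T i ω) ∂P = ∫⁻ t, f t ∂μ := by
  simpa using h.lintegral_tsum_mul_negExp hT hf (measurable_const (a := 0))

/-- By Campbell's formula the expected number of points in a null set is zero. -/
lemma HasPoissonLaplace.ae_forall (h : HasPoissonLaplace P T μ)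
    (hT : ∀ i, Measurable (T i)) {p : E → Prop} (hp : ∀ᵐ t ∂μ, p t) :
    ∀ᵐ ω ∂P, ∀ i, p (T i ω) := by
  let s := toMeasurable μ {t | ¬ p t}
  have hs : MeasurableSet s := measurableSet_toMeasurable _ _
  have h0 := h.campbell hT (measurable_one.indicator hs)
  have hm : Measurable fun ω => ∑' i, s.indicator (1 : E → ℝ≥0∞) (T i ω) :=
    Measurable.tsum fun i => (measurable_one.indicator hs).comp (hT i)
  rw [lintegral_indicator_one hs, measure_toMeasurable, show μ {t | ¬ p t} = 0 from hp,
    lintegral_eq_zero_iff hm] at h0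
  filter_upwards [h0] with ω hω i
  by_contra hi
  have h1 := (ENNReal.tsum_eq_zero.1 hω) i
  have hmem : T i ω ∈ s := subset_toMeasurable _ _ hi
  simp [hmem] at h1

lemma measurable_sumOthers (hT : ∀ i, Measurable (T i)) {φ : E → ℝ≥0∞} (hφ : Measurable φ)
    (i : ℕ) : Measurable (sumOthers T φ i) := by
  refine Measurable.tsum fun j => ?_
  split_ifs
  · exact measurable_const
  · exact hφ.comp (hT j)

variable [IsProbabilityMeasure P]

/-- Both sides are finite measures in `t`, so it suffices to compare their Laplace transforms by the
exponential Mecke formula. -/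
lemma HasPoissonLaplace.tsum_measure_mem_sumOthers_of_lt_top (h : HasPoissonLaplace P T μ)
    (hT : ∀ i, Measurable (T i)) {φ : E → ℝ≥0∞} (hφ : Measurable φ) (hφt : ∀ᵐ t ∂μ, φ t ≠ ⊤)
    {s : Set E} (hs : MeasurableSet s) (hμs : μ s < ⊤) {t : Set ℝ≥0∞} (ht : MeasurableSet t) :
    ∑' i, P {ω | T i ω ∈ s ∧ sumOthers T φ i ω ∈ t} =
      μ s * P.map (fun ω => ∑' j, φ (T j ω)) t := by
  have hI : Measurable fun ω => ∑' j, φ (T j ω) := Measurable.tsum fun j => hφ.comp (hT j)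
  have hJ := measurable_sumOthers hT hφ
  let m : Measure ℝ≥0∞ :=
    Measure.sum fun i => (P.restrict (T i ⁻¹' s)).map (sumOthers T φ i)
  have hL : ∀ k : ℕ, ∫⁻ x, negExp (k * x) ∂m =
      ∫⁻ x, negExp (k * x) ∂(μ s • P.map (fun ω => ∑' j, φ (T j ω))) := by
    intro k
    have hk : Measurable fun x : ℝ≥0∞ => negExp (k * x) :=
      measurable_negExp.comp (measurable_id.const_mul _)
    have hkφ : Measurable fun t => (k : ℝ≥0∞) * φ t := hφ.const_mul _
    -- The weight `exp (k * φ)` cancels the contribution of the point itself to the full sum,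
    -- leaving the sum over the others. The cancellation needs `φ` finite.
    let f : E → ℝ≥0∞ := s.indicator fun t => (negExp (k * φ t))⁻¹
    have hf : Measurable f := (measurable_negExp.comp hkφ).inv.indicator hs
    have hcancel : ∀ t, φ t ≠ ⊤ → f t * negExp (k * φ t) = s.indicator 1 t := by
      intro t ht
      by_cases hts : t ∈ s
      · simp only [f, Set.indicator_of_mem hts, Pi.one_apply]
        exact ENNReal.inv_mul_cancel (negExp_ne_zero (ENNReal.mul_ne_top (by simp) ht))
          (negExp_ne_top _)
      · simp [f, hts]
    have h1 : ∀ i, ∫⁻ x, negExp (k * x) ∂((P.restrict (T i ⁻¹' s)).map (sumOthers T φ i)) =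
        ∫⁻ ω, s.indicator 1 (T i ω) * negExp (k * sumOthers T φ i ω) ∂P := by
      intro i
      rw [lintegral_map hk (hJ i), ← lintegral_indicator (hT i hs)]
      refine lintegral_congr fun ω => ?_
      by_cases hω : T i ω ∈ s
      · simp [hω]
      · simp [hω]
    have h2 : ∀ᵐ ω ∂P, ∑' i, s.indicator 1 (T i ω) * negExp (k * sumOthers T φ i ω) =
        (∑' i, f (T i ω)) * negExp (∑' j, k * φ (T j ω)) := by
      filter_upwards [h.ae_forall hT hφt] with ω hω
      rw [← ENNReal.tsum_mul_right]
      refine tsum_congr fun i => ?_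
      rw [ENNReal.tsum_mul_left, ENNReal.tsum_eq_add_tsum_ite i, mul_add, negExp_add, ← mul_assoc,
        hcancel _ (hω i), sumOthers]
      congr!
    rw [lintegral_sum_measure, lintegral_smul_measure, lintegral_map hk hI]
    simp_rw [h1]
    have hmi : ∀ i, Measurable fun ω =>
        s.indicator 1 (T i ω) * negExp (k * sumOthers T φ i ω) := fun i =>
      ((measurable_one.indicator hs).comp (hT i)).mul (hk.comp (hJ i))
    rw [← lintegral_tsum fun i => (hmi i).aemeasurable, lintegral_congr_ae h2,
      h.lintegral_tsum_mul_negExp hT hf hkφ, ← h _ hkφ]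
    simp_rw [ENNReal.tsum_mul_left]
    rw [mul_comm, smul_eq_mul]
    congr 1
    rw [← lintegral_indicator_one hs]
    refine lintegral_congr_ae ?_
    filter_upwards [hφt] with t ht using hcancel t ht
  have : IsProbabilityMeasure (P.map fun ω => ∑' j, φ (T j ω)) :=
    Measure.isProbabilityMeasure_map hI.aemeasurable
  have hfin2 : IsFiniteMeasure (μ s • P.map (fun ω => ∑' j, φ (T j ω))) :=
    ⟨by simpa using hμs⟩
  have hfin1 : IsFiniteMeasure m := by
    constructor
    -- The transform at `k = 0` is the total mass.
    have := hL 0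
    simp only [CharP.cast_eq_zero, zero_mul, negExp_zero, lintegral_const, one_mul] at this
    rw [this]
    exact measure_lt_top _ _
  have hm := congrArg (fun m' => m' t) (measure_ext_of_lintegral_negExp hL)
  rw [Measure.sum_apply _ ht, Measure.smul_apply, smul_eq_mul] at hm
  rw [← hm]
  refine tsum_congr fun i => ?_
  rw [Measure.map_apply (hJ i) ht, Measure.restrict_apply (hJ i ht), Set.inter_comm]
  rfl

/-- The Mecke formula: a point of the process and the sum of `φ` over the other points. -/
theorem HasPoissonLaplace.sum_map_prodMk_sumOthers [SigmaFinite μ] (h : HasPoissonLaplace P T μ)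
    (hT : ∀ i, Measurable (T i)) {φ : E → ℝ≥0∞} (hφ : Measurable φ) (hφt : ∀ᵐ t ∂μ, φ t ≠ ⊤) :
    Measure.sum (fun i => P.map fun ω => (T i ω, sumOthers T φ i ω)) =
      μ.prod (P.map fun ω => ∑' j, φ (T j ω)) := by
  have hI : Measurable fun ω => ∑' j, φ (T j ω) := Measurable.tsum fun j => hφ.comp (hT j)
  have : IsProbabilityMeasure (P.map fun ω => ∑' j, φ (T j ω)) :=
    Measure.isProbabilityMeasure_map hI.aemeasurable
  have hJ := measurable_sumOthers hT hφ
  refine (Measure.prod_eq fun s t hs ht => ?_).symm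
  have hrect : ∀ s', MeasurableSet s' →
      Measure.sum (fun i => P.map fun ω => (T i ω, sumOthers T φ i ω)) (s' ×ˢ t) =
        ∑' i, P {ω | T i ω ∈ s' ∧ sumOthers T φ i ω ∈ t} := by
    intro s' hs'
    rw [Measure.sum_apply _ (hs'.prod ht)]
    refine tsum_congr fun i => ?_
    rw [Measure.map_apply ((hT i).prodMk (hJ i)) (hs'.prod ht)]
    rfl
  -- Exhaust `s` by sets of finite intensity, where the preceding lemma applies.
  have hmono : Monotone fun n => s ∩ spanningSets μ n := fun m n hmn =>
    Set.inter_subset_inter_right _ (monotone_spanningSets μ hmn)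
  have hU : s = ⋃ n, s ∩ spanningSets μ n := by
    rw [← Set.inter_iUnion, iUnion_spanningSets, Set.inter_univ]
  have hU' : s ×ˢ t = ⋃ n, (s ∩ spanningSets μ n) ×ˢ t := by
    rw [← Set.iUnion_prod_const, ← hU]
  rw [hU', Monotone.measure_iUnion fun m n hmn => Set.prod_mono (hmono hmn) le_rfl]
  conv_rhs => rw [hU, hmono.measure_iUnion, ENNReal.iSup_mul]
  refine iSup_congr fun n => ?_
  have hsn := hs.inter (measurableSet_spanningSets μ n)
  rw [hrect _ hsn, h.tsum_measure_mem_sumOthers_of_lt_top hT hφ hφt hsn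
    ((measure_mono Set.inter_subset_right).trans_lt (measure_spanningSets_lt_top μ n)) ht]

end

/-- Each `k * φ` is again a test function, so the intensity determines the Laplace transform of the
sum. -/
lemma HasPoissonLaplace.map_tsum_eq {Ω₁ Ω₂ E : Type*} [MeasurableSpace Ω₁] [MeasurableSpace Ω₂]
    [MeasurableSpace E] {P₁ : Measure Ω₁} {P₂ : Measure Ω₂} [IsProbabilityMeasure P₁]
    [IsProbabilityMeasure P₂] {T₁ : ℕ → Ω₁ → E} {T₂ : ℕ → Ω₂ → E} {μ : Measure E}
    (h₁ : HasPoissonLaplace P₁ T₁ μ) (h₂ : HasPoissonLaplace P₂ T₂ μ)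
    (hT₁ : ∀ i, Measurable (T₁ i)) (hT₂ : ∀ i, Measurable (T₂ i)) {φ : E → ℝ≥0∞}
    (hφ : Measurable φ) :
    P₁.map (fun ω => ∑' j, φ (T₁ j ω)) = P₂.map (fun ω => ∑' j, φ (T₂ j ω)) := by
  have hI₁ : Measurable fun ω => ∑' j, φ (T₁ j ω) := Measurable.tsum fun j => hφ.comp (hT₁ j)
  have hI₂ : Measurable fun ω => ∑' j, φ (T₂ j ω) := Measurable.tsum fun j => hφ.comp (hT₂ j)
  have := Measure.isProbabilityMeasure_map (μ := P₁) hI₁.aemeasurable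
  have := Measure.isProbabilityMeasure_map (μ := P₂) hI₂.aemeasurable
  refine measure_ext_of_lintegral_negExp fun k => ?_
  have hk : Measurable fun x : ℝ≥0∞ => negExp (k * x) :=
    measurable_negExp.comp (measurable_id.const_mul _)
  rw [lintegral_map hk hI₁, lintegral_map hk hI₂]
  simp_rw [← ENNReal.tsum_mul_left]
  rw [h₁ (fun t => k * φ t) (hφ.const_mul _), h₂ (fun t => k * φ t) (hφ.const_mul _)]

/-- If `Y` and `Z` are independent and `X` is independent of the pair, then `(X, Y)` and `Z` are
independent. -/
lemma ProbabilityTheory.IndepFun.prodMk_left_of_prodMk_right {Ω A B C : Type*} [MeasurableSpace Ω]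
    [MeasurableSpace A] [MeasurableSpace B] [MeasurableSpace C] {P : Measure Ω}
    [IsProbabilityMeasure P] {X : Ω → A} {Y : Ω → B} {Z : Ω → C} (hX : Measurable X)
    (hY : Measurable Y) (hZ : Measurable Z) (hXYZ : IndepFun X (fun ω => (Y ω, Z ω)) P)
    (hYZ : IndepFun Y Z P) : IndepFun (fun ω => (X ω, Y ω)) Z P := by
  have hXY : IndepFun X Y P := hXYZ.comp measurable_id measurable_fst
  rw [indepFun_iff_map_prod_eq_prod_map_map (hX.prodMk hY).aemeasurable hZ.aemeasurable,
    (indepFun_iff_map_prod_eq_prod_map_map hX.aemeasurable hY.aemeasurable).1 hXY]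
  have h1 := (indepFun_iff_map_prod_eq_prod_map_map hX.aemeasurable
    (hY.prodMk hZ).aemeasurable).1 hXYZ
  rw [(indepFun_iff_map_prod_eq_prod_map_map hY.aemeasurable hZ.aemeasurable).1 hYZ] at h1
  have := Measure.isProbabilityMeasure_map (μ := P) hX.aemeasurable
  have := Measure.isProbabilityMeasure_map (μ := P) hY.aemeasurable
  have := Measure.isProbabilityMeasure_map (μ := P) hZ.aemeasurable
  have h2 := congrArg (Measure.map MeasurableEquiv.prodAssoc.symm) h1
  rw [Measure.map_map MeasurableEquiv.prodAssoc.symm.measurable (hX.prodMk (hY.prodMk hZ))] at h2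
  rw [← Measure.prodAssoc_prod, MeasurableEquiv.map_symm_map] at h2
  exact h2

/-! ### The network in terms of displaced points -/

namespace HelloNetwork

variable {M : ℕ}

/-- Received power of a desired signal, as a function of location and reduced mark. -/
noncomputable def desiredPower (α : ℝ) (t : Plane × ReducedMark M) : ℝ≥0∞ :=
  ENNReal.ofReal t.2.1.1 * ENNReal.ofReal ‖t.1‖ ^ (-α)

/-- Received power of an interfering signal on the resource block `k`. -/
noncomputable def interferingPower (α : ℝ) (k : Fin M) (t : Plane × ReducedMark M) : ℝ≥0∞ :=
  if t.2.2 = (true, k) then ENNReal.ofReal t.2.1.2 * ENNReal.ofReal ‖t.1‖ ^ (-α) else 0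

/-- The pairs of a node and an interference level such that the node transmits on the resource block
`k` and is received above the threshold. -/
def successSet (α ξ : ℝ) (k : Fin M) : Set ((Plane × ReducedMark M) × ℝ≥0∞) :=
  {p | p.1.2.2 = (true, k) ∧ ENNReal.ofReal ξ < desiredPower α p.1 / p.2}

lemma measurable_desiredPower (α : ℝ) : Measurable (desiredPower α (M := M)) := by
  unfold desiredPower
  fun_prop

lemma measurable_interferingPower (α : ℝ) (k : Fin M) : Measurable (interferingPower α k) := by
  unfold interferingPower
  refine Measurable.ite ?_ (by fun_prop) measurable_const
  exact (measurableSet_singleton (true, k)).preimage (by fun_prop :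
    Measurable fun t : Plane × ReducedMark M => t.2.2)

lemma measurableSet_successSet (α ξ : ℝ) (k : Fin M) : MeasurableSet (successSet α ξ k) := by
  refine MeasurableSet.inter ?_ ?_
  · exact (measurableSet_singleton (true, k)).preimage (by fun_prop :
      Measurable fun p : (Plane × ReducedMark M) × ℝ≥0∞ => p.1.2.2)
  · exact measurableSet_lt measurable_const
      (((measurable_desiredPower α).comp measurable_fst).div measurable_snd)

/-- The identity behind the invariance: shadowing is a displacement and scaling is a common factor.
It holds for every real gain `a`, and at `v = 0`, where both sides are `⊤` if `a > 0`. -/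
lemma power_smul {α c θ : ℝ} (hα : 0 < α) (hc : 0 < c) (hθ : 0 < θ) (a : ℝ) (v : Plane) :
    ENNReal.ofReal (a * θ) * ENNReal.ofReal ‖v‖ ^ (-α) = ENNReal.ofReal (c ^ α) *
      (ENNReal.ofReal a * ENNReal.ofReal ‖c • θ ^ (-1 / α) • v‖ ^ (-α)) := by
  have hcα : 0 < c ^ α := Real.rpow_pos_of_pos hc _
  rw [ENNReal.ofReal_mul' hθ.le]
  rcases le_or_gt a 0 with ha | ha
  · simp [ENNReal.ofReal_of_nonpos ha]
  by_cases hv : v = 0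
  · have h0 : (0 : ℝ≥0∞) ^ (-α) = ⊤ := ENNReal.zero_rpow_of_neg (by linarith)
    simp [hv, h0, ENNReal.mul_top, ha, hθ, hcα]
  have hv' : 0 < ‖v‖ := norm_pos_iff.2 hv
  have hθα : 0 < θ ^ (-1 / α) := Real.rpow_pos_of_pos hθ _
  rw [norm_smul, norm_smul, Real.norm_of_nonneg hc.le, Real.norm_of_nonneg hθα.le,
    ENNReal.ofReal_rpow_of_pos hv', ENNReal.ofReal_rpow_of_pos (by positivity),
    ← ENNReal.ofReal_mul ha.le, ← ENNReal.ofReal_mul ha.le, ← ENNReal.ofReal_mul hcα.le,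
    ← ENNReal.ofReal_mul (by positivity)]
  congr 1
  rw [Real.mul_rpow hc.le (by positivity), Real.mul_rpow hθα.le hv'.le, ← Real.rpow_mul hθ.le,
    show -1 / α * -α = 1 by field_simp, Real.rpow_one, Real.rpow_neg hc.le]
  field_simp

section model

variable {Ω : Type*} (N : HelloNetwork Ω M)

/-- The displaced and scaled nodes, with their reduced marks. -/
noncomputable def points (α c : ℝ) (i : ℕ) (ω : Ω) : Plane × ReducedMark M :=
  reduce α c (N.X i ω, N.mark i ω)

lemma signal_eq {α c : ℝ} (hα : 0 < α) (hc : 0 < c) {i : ℕ} {ω : Ω} (hθ : 0 < N.θ i ω) :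
    N.signal α i ω = ENNReal.ofReal (c ^ α) * desiredPower α (N.points α c i ω) :=
  power_smul hα hc hθ _ _

lemma interference_eq {α c : ℝ} (hα : 0 < α) (hc : 0 < c) {ω : Ω} (hθ : ∀ j, 0 < N.θ j ω)
    (i : ℕ) :
    N.interference α i ω = ENNReal.ofReal (c ^ α) *
      sumOthers (N.points α c) (interferingPower α (N.K i ω)) i ω := by
  rw [interference, sumOthers, ← ENNReal.tsum_mul_left]
  refine tsum_congr fun j => ?_
  by_cases hj : j = i
  · simp [hj]
  simp only [hj, ne_eq, not_false_eq_true, true_and, if_false, interferingPower, points, reduce,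
    mark, Prod.mk.injEq]
  split_ifs with h
  · exact power_smul hα hc (hθ j) _ _
  · simp

/-- Absence of noise matters here: `c ^ α` cancels between signal and interference. -/
lemma sinr_eq {α c : ℝ} (hα : 0 < α) (hc : 0 < c) {ω : Ω} (hθ : ∀ j, 0 < N.θ j ω) (i : ℕ) :
    N.sinr α 0 i ω = desiredPower α (N.points α c i ω) /
      sumOthers (N.points α c) (interferingPower α (N.K i ω)) i ω := by
  have hcα : 0 < c ^ α := Real.rpow_pos_of_pos hc _
  rw [sinr, signal_eq N hα hc (hθ i), interference_eq N hα hc hθ, ENNReal.ofReal_zero, add_zero,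
    ENNReal.mul_div_mul_left _ _ (by simpa using hcα) ENNReal.ofReal_ne_top]

/-- The number of successful nodes of a sequence of nodes with reduced marks. -/
noncomputable def successCount {Ω' : Type*} (α ξ : ℝ) (T : ℕ → Ω' → Plane × ReducedMark M)
    (ω : Ω') : ℝ≥0∞ :=
  ∑' i, ∑ k, (successSet α ξ k).indicator 1 (T i ω, sumOthers T (interferingPower α k) i ω)

lemma measurable_successCount {Ω' : Type*} [MeasurableSpace Ω'] (α ξ : ℝ)
    {T : ℕ → Ω' → Plane × ReducedMark M} (hT : ∀ i, Measurable (T i)) :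
    Measurable (successCount α ξ T) :=
  Measurable.tsum fun i => Finset.measurable_fun_sum _ fun k _ =>
    (measurable_one.indicator (measurableSet_successSet α ξ k)).comp
      ((hT i).prodMk (measurable_sumOthers hT (measurable_interferingPower α k) i))

/-- The Mecke formula needs an interference function that does not depend on the chosen node. Hence
the sum over all blocks `k`, of which only the node's own block contributes. -/
lemma encard_discovered {α ξ c : ℝ} (hα : 0 < α) (hc : 0 < c) {ω : Ω} (hθ : ∀ j, 0 < N.θ j ω) :
    ((N.discovered α ξ 0 ω).encard : ℝ≥0∞) =
      successCount α ξ (N.points α c) ω * ({false} : Set Bool).indicator 1 (N.Z₀ ω) := by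
  rw [toENNReal_encard_eq_tsum, successCount, ← ENNReal.tsum_mul_right]
  refine tsum_congr fun i => ?_
  rw [Finset.sum_eq_single (N.K i ω)]
  · by_cases h0 : N.Z₀ ω = false
    · rw [Set.indicator_of_mem (by simpa using h0 : N.Z₀ ω ∈ ({false} : Set Bool)), Pi.one_apply,
        mul_one]
      have hiff : i ∈ N.discovered α ξ 0 ω ↔ (N.points α c i ω,
          sumOthers (N.points α c) (interferingPower α (N.K i ω)) i ω) ∈
            successSet α ξ (N.K i ω) := by
        simp only [discovered, successSet, Set.mem_ofPred_eq, sinr_eq N hα hc hθ, h0, true_and]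
        simp [points, reduce, mark]
      by_cases hi : i ∈ N.discovered α ξ 0 ω
      · rw [Set.indicator_of_mem hi, Set.indicator_of_mem (hiff.1 hi)]; rfl
      · rw [Set.indicator_of_notMem hi, Set.indicator_of_notMem fun h => hi (hiff.2 h)]
    · rw [Set.indicator_of_notMem (by simpa using h0 : N.Z₀ ω ∉ ({false} : Set Bool)), mul_zero,
        Set.indicator_of_notMem]
      exact fun h => h0 h.1
  · intro k _ hk
    rw [Set.indicator_of_notMem]
    rintro ⟨h, -⟩
    exact hk (congrArg Prod.snd h).symm
  · simp

variable {N} [MeasurableSpace Ω] {P : Measure Ω} {lam ρ α : ℝ} {κ : Measure (ℝ × ℝ)}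
  {ν : Measure ℝ}

lemma IsModel.measurable_points (hN : N.IsModel P lam ρ κ ν) (α c : ℝ) (i : ℕ) :
    Measurable (N.points α c i) :=
  (measurable_reduce α c).comp ((hN.ppp.measurable i).prodMk (hN.measurable_mark i))

lemma isProbabilityMeasure_uniformOn_univ (hM : 0 < M) :
    IsProbabilityMeasure (uniformOn (Set.univ : Set (Fin M))) :=
  have : Nonempty (Fin M) := ⟨⟨0, hM⟩⟩
  isProbabilityMeasure_uniformOn Set.finite_univ Set.univ_nonempty

lemma isProbabilityMeasure_prod_transmitLaw (hρ0 : 0 ≤ ρ) (hρ1 : ρ ≤ 1) (hM : 0 < M) :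
    IsProbabilityMeasure ((transmitLaw ρ).prod (uniformOn (Set.univ : Set (Fin M)))) :=
  have := isProbabilityMeasure_transmitLaw hρ0 hρ1
  have := isProbabilityMeasure_uniformOn_univ hM
  inferInstance

lemma isProbabilityMeasure_reducedLaw [IsProbabilityMeasure κ] (hρ0 : 0 ≤ ρ) (hρ1 : ρ ≤ 1)
    (hM : 0 < M) : IsProbabilityMeasure (reducedLaw M ρ κ) :=
  have := isProbabilityMeasure_prod_transmitLaw hρ0 hρ1 hM
  inferInstanceAs (IsProbabilityMeasure (κ.prod _))

lemma IsModel.ae_pos [SFinite κ] (hN : N.IsModel P lam ρ κ ν) (hν : IsShadowingLaw α ν) (hρ0 : 0 ≤ ρ)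
    (hρ1 : ρ ≤ 1) (hM : 0 < M) : ∀ᵐ ω ∂P, ∀ i, 0 < N.θ i ω := by
  have := hν.prob
  have := isProbabilityMeasure_prod_transmitLaw hρ0 hρ1 hM
  rw [ae_all_iff]
  intro i
  have h1 : ∀ᵐ q ∂ν.prod ((transmitLaw ρ).prod (uniformOn (Set.univ : Set (Fin M)))), 0 < q.1 :=
    Measure.quasiMeasurePreserving_fst.ae hν.pos
  have h2 : ∀ᵐ p ∂P.map (N.mark i), 0 < p.2.1 := by
    rw [hN.law_mark i]
    exact Measure.quasiMeasurePreserving_snd.ae h1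
  exact ae_of_ae_map (hN.measurable_mark i).aemeasurable h2

variable [IsProbabilityMeasure κ] [IsProbabilityMeasure P]

lemma IsModel.hasPoissonLaplace_points (hN : N.IsModel P lam ρ κ ν) (hlam : 0 ≤ lam)
    (hν : IsShadowingLaw α ν) (hρ0 : 0 ≤ ρ) (hρ1 : ρ ≤ 1) (hM : 0 < M) {c : ℝ} (hc : 0 < c) :
    HasPoissonLaplace P (N.points α c)
      (ENNReal.ofReal (lam * (c ^ 2)⁻¹ * ∫ t, t ^ (2 / α) ∂ν) •
        (volume : Measure Plane).prod (reducedLaw M ρ κ)) := by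
  have := hν.prob
  have := isProbabilityMeasure_prod_transmitLaw hρ0 hρ1 hM
  rw [reducedLaw, ← map_reduce hc hlam hν]
  exact ((hN.ppp.hasPoissonLaplace hlam).prodMk hN.ppp.measurable hN.measurable_mark hN.law_mark
    hN.indep_mark (hN.indep_location.comp measurable_id measurable_fst)).map (measurable_reduce α c)

/-- The displacement theorem for the shadowed nodes. -/
theorem IsModel.isHomogeneousPPP_displaced (hN : N.IsModel P lam ρ κ ν) (hlam : 0 ≤ lam)
    (hν : IsShadowingLaw α ν) (hρ0 : 0 ≤ ρ) (hρ1 : ρ ≤ 1) (hM : 0 < M) :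
    IsHomogeneousPPP P (N.displaced α) (lam * ∫ t, t ^ (2 / α) ∂ν) := by
  have := isProbabilityMeasure_reducedLaw (κ := κ) hρ0 hρ1 hM
  have hI : 0 ≤ ∫ t, t ^ (2 / α) ∂ν := integral_nonneg_of_ae <| by
    filter_upwards [hν.pos] with t ht using Real.rpow_nonneg ht.le _
  have hfst : ∀ i ω, (N.points α 1 i ω).1 = N.displaced α i ω := fun i ω => one_smul ℝ _
  -- No scaling (`c = 1`), and the remaining marks are forgotten.
  have h := (hN.hasPoissonLaplace_points hlam hν hρ0 hρ1 hM one_pos).map measurable_fst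
  simp only [hfst, one_pow, inv_one, mul_one, Measure.map_smul, Measure.map_fst_prod,
    measure_univ, one_smul] at h
  refine HasPoissonLaplace.isHomogeneousPPP (mul_nonneg hlam hI) (fun i => ?_) h
  rw [show N.displaced α i = fun ω => (N.points α 1 i ω).1 from funext fun ω => (hfst i ω).symm]
  exact measurable_fst.comp (hN.measurable_points α 1 i)

/-- The scaling that turns the density of the displaced nodes into `1`. -/
lemma IsModel.exists_hasPoissonLaplace_points (hN : N.IsModel P lam ρ κ ν) (hlam : 0 < lam)
    (hν : IsShadowingLaw α ν) (hρ0 : 0 ≤ ρ) (hρ1 : ρ ≤ 1) (hM : 0 < M) :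
    ∃ c : ℝ, 0 < c ∧ HasPoissonLaplace P (N.points α c)
      ((volume : Measure Plane).prod (reducedLaw M ρ κ)) := by
  have := hν.prob
  have hI : 0 < ∫ t, t ^ (2 / α) ∂ν := by
    have hpos : ∀ᵐ t ∂ν, 0 < t ^ (2 / α) := by
      filter_upwards [hν.pos] with t ht using Real.rpow_pos_of_pos ht _
    rw [integral_pos_iff_support_of_nonneg_ae (hpos.mono fun t ht => ht.le) hν.moment]
    rw [pos_iff_ne_zero]
    intro h0
    have hfalse : ∀ᵐ t ∂ν, False := by
      filter_upwards [hpos, measure_eq_zero_iff_ae_notMem.1 h0] with t ht ht'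
      exact ht' ht.ne'
    exact IsProbabilityMeasure.ne_zero ν (by simpa using hfalse)
  -- Scaling by `c` divides a planar density by `c ^ 2`, so `c ^ 2` is the density of the displaced
  -- points.
  refine ⟨√(lam * ∫ t, t ^ (2 / α) ∂ν), by positivity, ?_⟩
  have h := hN.hasPoissonLaplace_points hlam.le hν hρ0 hρ1 hM
    (c := √(lam * ∫ t, t ^ (2 / α) ∂ν)) (by positivity)
  rw [Real.sq_sqrt (by positivity)] at h
  have h1 : lam * (lam * ∫ t, t ^ (2 / α) ∂ν)⁻¹ * ∫ t, t ^ (2 / α) ∂ν = 1 := by field_simp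
  rwa [h1, ENNReal.ofReal_one, one_smul] at h

/-- The success count is a function of locations and marks, which are jointly independent of the
typical node's state; the probability of receiving factors out. -/
lemma IsModel.meanDiscovered_eq_mul (hN : N.IsModel P lam ρ κ ν) (hα : 0 < α)
    (hν : IsShadowingLaw α ν) (hρ0 : 0 ≤ ρ) (hρ1 : ρ ≤ 1) (hM : 0 < M) (ξ : ℝ) {c : ℝ}
    (hc : 0 < c) :
    N.meanDiscovered P α ξ 0 =
      (∫⁻ ω, successCount α ξ (N.points α c) ω ∂P) * transmitLaw ρ {false} := by
  have h1 : N.meanDiscovered P α ξ 0 = ∫⁻ ω, successCount α ξ (N.points α c) ω *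
      ({false} : Set Bool).indicator 1 (N.Z₀ ω) ∂P := by
    refine lintegral_congr_ae ?_
    filter_upwards [hN.ae_pos hν hρ0 hρ1 hM] with ω hω
    exact N.encard_discovered hα hc hω
  have hX : Measurable fun ω i => N.X i ω := measurable_pi_lambda _ hN.ppp.measurable
  have hm : Measurable fun ω i => N.mark i ω := measurable_pi_lambda _ hN.measurable_mark
  have hind := IndepFun.prodMk_left_of_prodMk_right hX hm hN.measurable_state hN.indep_location
    hN.indep_mark_state
  have hS := measurable_successCount α ξ (hN.measurable_points α c)
  have hZ : Measurable fun ω => ({false} : Set Bool).indicator (1 : Bool → ℝ≥0∞) (N.Z₀ ω) :=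
    (measurable_of_countable (({false} : Set Bool).indicator 1)).comp hN.measurable_state
  have hT' : ∀ i, Measurable fun p : (ℕ → Plane) × (ℕ → (ℝ × ℝ) × ℝ × Bool × Fin M) =>
      reduce α c (p.1 i, p.2 i) := fun i => (measurable_reduce α c).comp (by fun_prop)
  have hind' : IndepFun (successCount α ξ (N.points α c))
      (fun ω => ({false} : Set Bool).indicator (1 : Bool → ℝ≥0∞) (N.Z₀ ω)) P :=
    hind.comp (measurable_successCount α ξ hT') (measurable_of_countable
      (({false} : Set Bool).indicator (1 : Bool → ℝ≥0∞)))
  rw [h1, lintegral_mul_eq_lintegral_mul_lintegral_of_indepFun'' hS.aemeasurable hZ.aemeasurable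
    hind', ← hN.law_state, ← lintegral_indicator_one (measurableSet_singleton false),
    lintegral_map (measurable_of_countable _) hN.measurable_state]

end model

/-! ### The mean number of successes -/

lemma ae_interferingPower_ne_top (α : ℝ) (k : Fin M) (Q : Measure (ReducedMark M)) [SFinite Q] :
    ∀ᵐ t ∂(volume : Measure Plane).prod Q, interferingPower α k t ≠ ⊤ := by
  have h0 : ∀ᵐ y : Plane, y ≠ 0 := by simp [ae_iff]
  filter_upwards [Measure.quasiMeasurePreserving_fst.ae h0] with t ht
  rw [interferingPower]
  split_ifs
  · refine ENNReal.mul_ne_top ENNReal.ofReal_ne_top ?_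
    rw [ENNReal.ofReal_rpow_of_pos (norm_pos_iff.2 ht)]
    exact ENNReal.ofReal_ne_top
  · simp

/-- The Mecke formula, block by block: a node and the interference it sees act as an independent
pair of a point drawn from the intensity and the full interference. -/
lemma lintegral_successCount {Ω : Type*} [MeasurableSpace Ω] {P : Measure Ω}
    [IsProbabilityMeasure P] {T : ℕ → Ω → Plane × ReducedMark M} {Q : Measure (ReducedMark M)}
    [IsProbabilityMeasure Q] (h : HasPoissonLaplace P T ((volume : Measure Plane).prod Q))
    (hT : ∀ i, Measurable (T i)) (α ξ : ℝ) :
    ∫⁻ ω, successCount α ξ T ω ∂P = ∑ k, ((volume : Measure Plane).prod Q).prod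
      (P.map fun ω => ∑' j, interferingPower α k (T j ω)) (successSet α ξ k) := by
  have hpair : ∀ i k, Measurable fun ω => (T i ω, sumOthers T (interferingPower α k) i ω) :=
    fun i k => (hT i).prodMk (measurable_sumOthers hT (measurable_interferingPower α k) i)
  have hind : ∀ i k, Measurable fun ω => (successSet α ξ k).indicator (1 : _ × ℝ≥0∞ → ℝ≥0∞)
      (T i ω, sumOthers T (interferingPower α k) i ω) := fun i k =>
    (measurable_one.indicator (measurableSet_successSet α ξ k)).comp (hpair i k)
  simp_rw [← h.sum_map_prodMk_sumOthers hT (measurable_interferingPower α _)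
    (ae_interferingPower_ne_top α _ Q)]
  simp_rw [Measure.sum_apply _ (measurableSet_successSet α ξ _), successCount]
  rw [lintegral_tsum fun i => (Finset.measurable_fun_sum _ fun k _ => hind i k).aemeasurable,
    ← Summable.tsum_finsetSum fun _ _ => ENNReal.summable]
  refine tsum_congr fun i => ?_
  rw [lintegral_finsetSum _ fun k _ => hind i k]
  refine Finset.sum_congr rfl fun k _ => ?_
  rw [← lintegral_indicator_one (measurableSet_successSet α ξ k),
    lintegral_map (measurable_one.indicator (measurableSet_successSet α ξ k)) (hpair i k)]

end HelloNetwork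

/-! ### Finiteness of the mean -/

lemma gammaMeasure_Ioi_zero_ne_zero {a r : ℝ} (ha : 0 < a) (hr : 0 < r) :
    gammaMeasure a r (Set.Ioi 0) ≠ 0 := by
  have := isProbabilityMeasure_gammaMeasure ha hr
  have h0 : gammaMeasure a r (Set.Iic 0) = 0 := by
    rw [gammaMeasure, withDensity_apply _ measurableSet_Iic,
      ← setLIntegral_congr Iio_ae_eq_Iic, lintegral_gammaPDF_of_nonpos le_rfl]
  rw [← Set.compl_Iic, prob_compl_eq_one_sub measurableSet_Iic, h0]
  simp

lemma lintegral_id_gammaMeasure {a r : ℝ} (ha : 0 < a) (hr : 0 < r) :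
    ∫⁻ x, ENNReal.ofReal x ∂gammaMeasure a r = ENNReal.ofReal (a / r) := by
  have hmeas : ∀ b : ℝ, Measurable (gammaPDF b r) := fun b =>
    (measurable_gammaPDFReal b r).ennreal_ofReal
  rw [gammaMeasure, lintegral_withDensity_eq_lintegral_mul _ (hmeas a) ENNReal.measurable_ofReal]
  have h : ∀ x, gammaPDF a r x * ENNReal.ofReal x =
      ENNReal.ofReal (a / r) * gammaPDF (a + 1) r x := by
    intro x
    rcases lt_or_ge x 0 with hx | hx
    · simp [gammaPDF_of_neg hx]
    rw [gammaPDF, gammaPDF, ← ENNReal.ofReal_mul (gammaPDFReal_nonneg ha hr x),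
      ← ENNReal.ofReal_mul (by positivity)]
    congr 1
    simp only [gammaPDFReal, if_pos hx]
    have hΓ := (Real.Gamma_pos_of_pos ha).ne'
    rw [Real.Gamma_add_one ha.ne', Real.rpow_add hr, Real.rpow_one, add_sub_cancel_right]
    rcases hx.eq_or_lt with rfl | hx
    · simp [ha.ne']
    · rw [Real.rpow_sub_one hx.ne']
      field_simp
  simp only [Pi.mul_apply, h]
  rw [lintegral_const_mul _ (hmeas _), lintegral_gammaPDF_eq_one (by linarith) hr, mul_one]

/-- For `0 ≤ p ≤ 1` and `x > 0`, `x ^ p ≤ 1 + x`, so the mean suffices. -/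
lemma lintegral_rpow_gammaMeasure_lt_top {a r p : ℝ} (ha : 0 < a) (hr : 0 < r) (hp0 : 0 ≤ p)
    (hp1 : p ≤ 1) :
    ∫⁻ x, (Set.Ioi (0 : ℝ)).indicator (fun x => ENNReal.ofReal (x ^ p)) x ∂gammaMeasure a r < ⊤ := by
  have := isProbabilityMeasure_gammaMeasure ha hr
  have hle : ∀ x : ℝ, (Set.Ioi (0 : ℝ)).indicator (fun x => ENNReal.ofReal (x ^ p)) x ≤
      1 + ENNReal.ofReal x := by
    refine fun x => Set.indicator_apply_le' (fun hx => ?_) (fun _ => zero_le)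
    have hx : 0 < x := hx
    rw [← ENNReal.ofReal_one, ← ENNReal.ofReal_add zero_le_one hx.le]
    apply ENNReal.ofReal_le_ofReal
    rcases le_total x 1 with h | h
    · linarith [Real.rpow_le_one hx.le h hp0]
    · have := Real.rpow_le_rpow_of_exponent_le h hp1
      rw [Real.rpow_one] at this
      linarith
  refine (lintegral_mono hle).trans_lt ?_
  rw [lintegral_add_left measurable_const, lintegral_id_gammaMeasure ha hr]
  simp

lemma lintegral_negExp_sq_norm_lt_top :
    ∫⁻ y : Plane, negExp (ENNReal.ofReal (‖y‖ ^ 2)) < ⊤ := by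
  have h := (GaussianFourier.integrable_cexp_neg_mul_sq_norm_add (V := Plane) (b := 1)
    (by simp) 0 0).norm
  have h' : Integrable fun y : Plane => Real.exp (-‖y‖ ^ 2) := by
    refine h.congr (ae_of_all _ fun y => ?_)
    simp only [Complex.norm_exp]
    congr 1
    simp [← Complex.ofReal_pow]
  refine lt_of_eq_of_lt (lintegral_congr fun y => ?_) h'.lintegral_lt_top
  rw [negExp_ofReal (by positivity)]

namespace HelloNetwork

variable {M : ℕ} {α ρ : ℝ} {κ : Measure (ℝ × ℝ)} {Q : Measure (ReducedMark M)}

/-- Multiplying powers by `s` amounts to moving points by `s ^ (-1 / α)`, which changes area by `s ^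
(2 / α)`. The interference is thus stable with index `2 / α`, whether or not the integral is finite.
-/
lemma lintegral_one_sub_negExp_mul_interferingPower [SFinite Q] (hα : 0 < α) (k : Fin M) {s : ℝ}
    (hs : 0 < s) :
    ∫⁻ t, (1 - negExp (ENNReal.ofReal s * interferingPower α k t)) ∂(volume : Measure Plane).prod Q
      = ENNReal.ofReal (s ^ (2 / α)) *
        ∫⁻ t, (1 - negExp (interferingPower α k t)) ∂(volume : Measure Plane).prod Q := by
  have hsm : ∀ t : Plane × ReducedMark M, ENNReal.ofReal s * interferingPower α k t =
      interferingPower α k (s ^ (-1 / α) • t.1, t.2) := by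
    intro t
    unfold interferingPower
    split_ifs
    · have := power_smul hα one_pos hs t.2.1.2 t.1
      rw [Real.one_rpow, ENNReal.ofReal_one, one_mul, one_smul, ENNReal.ofReal_mul' hs.le] at this
      rw [← this]
      ring
    · simp
  have hm : Measurable fun t : Plane × ReducedMark M => 1 - negExp (interferingPower α k t) :=
    measurable_const.sub (measurable_negExp.comp (measurable_interferingPower α k))
  have hm' : Measurable fun t : Plane × ReducedMark M =>
      1 - negExp (interferingPower α k (s ^ (-1 / α) • t.1, t.2)) :=
    hm.comp (g := fun t => 1 - negExp (interferingPower α k t))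
      (f := fun t : Plane × ReducedMark M => (s ^ (-1 / α) • t.1, t.2)) (by fun_prop)
  simp_rw [hsm]
  rw [lintegral_prod_symm _ hm'.aemeasurable, lintegral_prod_symm _ hm.aemeasurable,
    ← lintegral_const_mul' _ _ ENNReal.ofReal_ne_top]
  refine lintegral_congr fun q => ?_
  have hmq : Measurable fun y : Plane => 1 - negExp (interferingPower α k (y, q)) :=
    hm.comp measurable_prodMk_right
  have := lintegral_plane_smul (Real.rpow_pos_of_pos hs (-1 / α)) hmq
  rw [this]
  congr 2
  rw [← Real.rpow_natCast, ← Real.rpow_mul hs.le, ← Real.rpow_neg hs.le]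
  congr 1
  push_cast
  ring

lemma lintegral_one_sub_negExp_interferingPower_ne_zero (hM : 0 < M) (hρ : 0 < ρ) (hρ1 : ρ ≤ 1)
    [IsProbabilityMeasure κ] (hκ : κ (Prod.snd ⁻¹' Set.Ioi 0) ≠ 0) (k : Fin M) :
    ∫⁻ t, (1 - negExp (interferingPower α k t)) ∂(volume : Measure Plane).prod (reducedLaw M ρ κ)
      ≠ 0 := by
  have := isProbabilityMeasure_transmitLaw hρ.le hρ1
  have := isProbabilityMeasure_uniformOn_univ hM
  have hm : Measurable fun t : Plane × ReducedMark M => 1 - negExp (interferingPower α k t) :=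
    measurable_const.sub (measurable_negExp.comp (measurable_interferingPower α k))
  let s : Set (Plane × ReducedMark M) := {0}ᶜ ×ˢ ((Prod.snd ⁻¹' Set.Ioi 0) ×ˢ ({true} ×ˢ {k}))
  have hs : ((volume : Measure Plane).prod (reducedLaw M ρ κ)) s ≠ 0 := by
    rw [reducedLaw, Measure.prod_prod, Measure.prod_prod, Measure.prod_prod]
    refine mul_ne_zero ?_ (mul_ne_zero hκ (mul_ne_zero ?_ ?_))
    · rw [measure_compl (measurableSet_singleton _) (by simp)]
      simp
    · simp [transmitLaw, hρ]
    · simp [uniformOn_univ]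
  rw [Ne, lintegral_eq_zero_iff hm]
  intro h0
  refine hs (measure_mono_null (fun t ht => ?_) h0)
  obtain ⟨hy, hg, hz, hk⟩ := ht
  have hy : 0 < ‖t.1‖ := norm_pos_iff.2 hy
  have hg : 0 < t.2.1.2 := hg
  have htk : t.2.2 = (true, k) := Prod.ext hz hk
  have hpos : interferingPower α k t ≠ 0 := by
    rw [interferingPower, if_pos htk, ENNReal.ofReal_rpow_of_pos hy]
    exact mul_ne_zero (by simpa using hg) (by simpa using Real.rpow_pos_of_pos hy _)
  have hlt : negExp (interferingPower α k t) < 1 := by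
    simpa using negExp_strictAnti (pos_iff_ne_zero.2 hpos)
  exact (tsub_pos_of_lt hlt).ne'

/-- Chernoff bound for the probability that a node is received above the threshold. -/
lemma measure_successSet_section_le (L : Measure ℝ≥0∞) (ξ : ℝ) (k : Fin M)
    (t : Plane × ReducedMark M) :
    L (Prod.mk t ⁻¹' successSet α ξ k) ≤
      (negExp 1)⁻¹ * ∫⁻ x, negExp (ENNReal.ofReal ξ / desiredPower α t * x) ∂L := by
  have hm : MeasurableSet (Prod.mk t ⁻¹' successSet α ξ k) :=
    measurable_prodMk_left (measurableSet_successSet α ξ k)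
  have hinv : (negExp 1)⁻¹ ≠ ⊤ := ENNReal.inv_ne_top.2 (negExp_ne_zero ENNReal.one_ne_top)
  rw [← lintegral_indicator_one hm, ← lintegral_const_mul' _ _ hinv]
  refine lintegral_mono fun x => Set.indicator_apply_le' (fun hx => ?_) (fun _ => zero_le)
  -- On the success event the exponent is at most `1`, so `exp 1` times the exponential is at least
  -- `1`.
  have h1 : ENNReal.ofReal ξ * x < desiredPower α t := ENNReal.mul_lt_of_lt_div hx.2
  have h2 : ENNReal.ofReal ξ / desiredPower α t * x ≤ 1 := by
    rw [ENNReal.div_eq_inv_mul, mul_assoc, ← ENNReal.div_eq_inv_mul]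
    exact ENNReal.div_le_of_le_mul (by simpa using h1.le)
  calc (1 : ℝ≥0∞) = (negExp 1)⁻¹ * negExp 1 :=
        (ENNReal.inv_mul_cancel (negExp_ne_zero ENNReal.one_ne_top) (negExp_ne_top _)).symm
    _ ≤ _ := by gcongr; exact negExp_strictAnti.antitone h2

lemma prod_successSet_lt_top {ξ : ℝ} {ms mi : ℕ} (hα : 2 < α) (hξ : 0 < ξ) (hρ : 0 < ρ)
    (hρ1 : ρ ≤ 1) (hM : 0 < M) (hms : 0 < ms) (hmi : 0 < mi) (hκ : IsNakagamiPair ms mi κ)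
    [IsProbabilityMeasure κ] {L : Measure ℝ≥0∞} [SFinite L] (k : Fin M)
    (hL : ∀ r, ∫⁻ x, negExp (r * x) ∂L = negExp (∫⁻ t, (1 - negExp (r * interferingPower α k t))
      ∂(volume : Measure Plane).prod (reducedLaw M ρ κ))) :
    (((volume : Measure Plane).prod (reducedLaw M ρ κ)).prod L) (successSet α ξ k) < ⊤ := by
  have hα0 : 0 < α := by linarith
  have := isProbabilityMeasure_reducedLaw (κ := κ) hρ.le hρ1 hM
  have := isProbabilityMeasure_prod_transmitLaw hρ.le hρ1 hM
  have hg : κ (Prod.snd ⁻¹' Set.Ioi 0) ≠ 0 := by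
    rw [← Measure.map_apply measurable_snd measurableSet_Ioi, hκ.2]
    exact gammaMeasure_Ioi_zero_ne_zero (by exact_mod_cast hmi) (by exact_mod_cast hmi)
  -- A positive real lower bound is enough; finiteness of the integral is not needed.
  obtain ⟨C, hC0, hC⟩ : ∃ C : ℝ, 0 < C ∧ ENNReal.ofReal C ≤ ∫⁻ t, (1 - negExp
      (interferingPower α k t)) ∂(volume : Measure Plane).prod (reducedLaw M ρ κ) := by
    obtain ⟨C, hC0, hC⟩ := ENNReal.lt_iff_exists_nnreal_btwn.1 (pos_iff_ne_zero.2
      (lintegral_one_sub_negExp_interferingPower_ne_zero (α := α) hM hρ hρ1 hg k))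
    exact ⟨C, by exact_mod_cast hC0, by simpa using hC.le⟩
  -- The Chernoff bound: with `s = ξ * ‖x‖ ^ α / h`, `C * s ^ (2 / α) = C * (ξ / h) ^ (2 / α) * ‖x‖
  -- ^ 2`, written as the squared norm of a scaled point so that `lintegral_plane_smul` integrates
  -- it.
  let b : Plane × ReducedMark M → ℝ≥0∞ := fun t => if 0 < t.2.1.1 then
    (negExp 1)⁻¹ * negExp (ENNReal.ofReal (‖(√C * (ξ / t.2.1.1) ^ (1 / α)) • t.1‖ ^ 2)) else 0
  have hb : Measurable b := by
    refine Measurable.ite (measurableSet_lt measurable_const (by fun_prop)) ?_ measurable_const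
    exact (measurable_negExp.comp (by fun_prop)).const_mul _
  have hy0 : ∀ᵐ t ∂(volume : Measure Plane).prod (reducedLaw M ρ κ), t.1 ≠ 0 :=
    Measure.quasiMeasurePreserving_fst.ae (p := fun y => y ≠ 0) (by simp [ae_iff])
  have hle : ∀ᵐ t ∂(volume : Measure Plane).prod (reducedLaw M ρ κ),
      L (Prod.mk t ⁻¹' successSet α ξ k) ≤ b t := by
    filter_upwards [hy0] with t ht
    have hy : 0 < ‖t.1‖ := norm_pos_iff.2 ht
    by_cases hh : 0 < t.2.1.1
    · refine (measure_successSet_section_le L ξ k t).trans ?_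
      simp only [b, if_pos hh]
      gcongr
      have hr : ENNReal.ofReal ξ / desiredPower α t =
          ENNReal.ofReal (ξ / t.2.1.1 * ‖t.1‖ ^ α) := by
        have : 0 < ‖t.1‖ ^ (-α) := Real.rpow_pos_of_pos hy _
        rw [desiredPower, ENNReal.ofReal_rpow_of_pos hy, ← ENNReal.ofReal_mul hh.le,
          ← ENNReal.ofReal_div_of_pos (by positivity), Real.rpow_neg hy.le]
        congr 1
        field_simp
      rw [hr, hL, lintegral_one_sub_negExp_mul_interferingPower hα0 k
        (mul_pos (div_pos hξ hh) (Real.rpow_pos_of_pos hy _))]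
      apply negExp_strictAnti.antitone
      refine le_trans (le_of_eq ?_) (mul_le_mul_right hC _)
      rw [← ENNReal.ofReal_mul (Real.rpow_nonneg (by positivity) _)]
      congr 1
      have hξh : 0 < ξ / t.2.1.1 := div_pos hξ hh
      rw [norm_smul, mul_pow, Real.norm_of_nonneg (by positivity), mul_pow, Real.sq_sqrt hC0.le,
        Real.mul_rpow hξh.le (by positivity), ← Real.rpow_mul hy.le,
        mul_div_cancel₀ _ hα0.ne', Real.rpow_two, ← Real.rpow_natCast (_ ^ (1 / α)),
        ← Real.rpow_mul hξh.le]
      push_cast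
      rw [show 1 / α * 2 = 2 / α by ring]
      ring
    · have : Prod.mk t ⁻¹' successSet α ξ k = ∅ := by
        rw [Set.eq_empty_iff_forall_notMem]
        intro x hx
        have h0 : desiredPower α t = 0 := by
          simp [desiredPower, ENNReal.ofReal_of_nonpos (not_lt.1 hh)]
        have hx2 := hx.2
        simp [h0] at hx2
      simp [this]
  let W := ∫⁻ y : Plane, negExp (ENNReal.ofReal (‖y‖ ^ 2))
  have hWm : Measurable fun y : Plane => negExp (ENNReal.ofReal (‖y‖ ^ 2)) :=
    measurable_negExp.comp (by fun_prop)
  have hint : ∀ q : ReducedMark M, ∫⁻ y : Plane, b (y, q) =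
      (negExp 1)⁻¹ * ENNReal.ofReal (C * ξ ^ (2 / α))⁻¹ * W *
        (Set.Ioi (0 : ℝ)).indicator (fun x => ENNReal.ofReal (x ^ (2 / α))) q.1.1 := by
    intro q
    by_cases hh : 0 < q.1.1
    · have hξh : 0 < ξ / q.1.1 := div_pos hξ hh
      have ha : 0 < √C * (ξ / q.1.1) ^ (1 / α) :=
        mul_pos (Real.sqrt_pos.2 hC0) (Real.rpow_pos_of_pos hξh _)
      simp only [b, if_pos hh]
      rw [lintegral_const_mul' _ _ (ENNReal.inv_ne_top.2 (negExp_ne_zero ENNReal.one_ne_top)),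
        lintegral_plane_smul ha hWm, Set.indicator_of_mem (by simpa using hh)]
      have : ENNReal.ofReal ((√C * (ξ / q.1.1) ^ (1 / α)) ^ 2)⁻¹ =
          ENNReal.ofReal (C * ξ ^ (2 / α))⁻¹ * ENNReal.ofReal (q.1.1 ^ (2 / α)) := by
        rw [← ENNReal.ofReal_mul (by positivity)]
        congr 1
        rw [mul_pow, Real.sq_sqrt hC0.le, ← Real.rpow_natCast (_ ^ (1 / α)),
          ← Real.rpow_mul hξh.le]
        push_cast
        rw [show 1 / α * 2 = 2 / α by ring, Real.div_rpow hξ.le hh.le]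
        field_simp
      rw [this]
      ring
    · simp [b, hh]
  rw [Measure.prod_apply (measurableSet_successSet α ξ k)]
  refine (lintegral_mono_ae hle).trans_lt ?_
  rw [lintegral_prod_symm _ hb.aemeasurable]
  simp_rw [hint]
  have hind : Measurable ((Set.Ioi (0 : ℝ)).indicator fun x => ENNReal.ofReal (x ^ (2 / α))) :=
    Measurable.indicator (by fun_prop) measurableSet_Ioi
  have hmom : ∫⁻ q : ReducedMark M, (Set.Ioi (0 : ℝ)).indicator
      (fun x => ENNReal.ofReal (x ^ (2 / α))) q.1.1 ∂reducedLaw M ρ κ =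
      ∫⁻ x, (Set.Ioi (0 : ℝ)).indicator (fun x => ENNReal.ofReal (x ^ (2 / α))) x
        ∂gammaMeasure ms ms := by
    rw [← hκ.1, lintegral_map hind measurable_fst, ← lintegral_map
      (f := fun p : ℝ × ℝ => (Set.Ioi (0 : ℝ)).indicator
        (fun x => ENNReal.ofReal (x ^ (2 / α))) p.1) (hind.comp measurable_fst) measurable_fst,
      reducedLaw, Measure.map_fst_prod, measure_univ, one_smul]
  have hK : (negExp 1)⁻¹ * ENNReal.ofReal (C * ξ ^ (2 / α))⁻¹ * W ≠ ⊤ :=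
    ENNReal.mul_ne_top (ENNReal.mul_ne_top
      (ENNReal.inv_ne_top.2 (negExp_ne_zero ENNReal.one_ne_top)) ENNReal.ofReal_ne_top)
      lintegral_negExp_sq_norm_lt_top.ne
  rw [lintegral_const_mul' _ _ hK, hmom]
  refine ENNReal.mul_lt_top hK.lt_top (lintegral_rpow_gammaMeasure_lt_top (by exact_mod_cast hms)
    (by exact_mod_cast hms) (by positivity) ?_)
  rw [div_le_one hα0]
  exact hα.le

/-- The case `ρ = 0`: there is no interference to drive the Chernoff bound, but no node transmits
either. -/
lemma prod_successSet_eq_zero {ξ : ℝ} (hM : 0 < M) [IsProbabilityMeasure κ] {L : Measure ℝ≥0∞}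
    [SFinite L] (k : Fin M) :
    (((volume : Measure Plane).prod (reducedLaw M 0 κ)).prod L) (successSet α ξ k) = 0 := by
  have := isProbabilityMeasure_transmitLaw (le_refl 0) zero_le_one
  have := isProbabilityMeasure_uniformOn_univ hM
  have := isProbabilityMeasure_reducedLaw (κ := κ) (le_refl 0) zero_le_one hM
  have hz : ((volume : Measure Plane).prod (reducedLaw M 0 κ))
      (Set.univ ×ˢ (Set.univ ×ˢ ({true} ×ˢ Set.univ))) = 0 := by
    rw [reducedLaw, Measure.prod_prod, Measure.prod_prod, Measure.prod_prod]
    simp [transmitLaw]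
  refine measure_mono_null (t := (Set.univ ×ˢ (Set.univ ×ˢ ({true} ×ˢ Set.univ))) ×ˢ Set.univ)
    (fun p hp => ?_) (by rw [Measure.prod_prod, hz, zero_mul])
  have hp1 : p.1.2.2 = (true, k) := hp.1
  simp [hp1]

end HelloNetwork

/-! ### Assembly -/

theorem mainTheorem7 {α ξ ρ : ℝ} (hα : 2 < α) (hξ : 0 < ξ) (hρ0 : 0 ≤ ρ) (hρ1 : ρ ≤ 1)
    {M ms mi : ℕ} (hM : 0 < M) (hms : 0 < ms) (hmi : 0 < mi)
    (κ : Measure (ℝ × ℝ)) (hκ : IsNakagamiPair ms mi κ)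
    {Ω₁ Ω₂ : Type*} [MeasurableSpace Ω₁] [MeasurableSpace Ω₂]
    (P₁ : Measure Ω₁) (P₂ : Measure Ω₂) [IsProbabilityMeasure P₁] [IsProbabilityMeasure P₂]
    (lam₁ lam₂ : ℝ) (hlam₁ : 0 < lam₁) (hlam₂ : 0 < lam₂)
    (ν₁ ν₂ : Measure ℝ) (hν₁ : IsShadowingLaw α ν₁) (hν₂ : IsShadowingLaw α ν₂)
    (N₁ : HelloNetwork Ω₁ M) (N₂ : HelloNetwork Ω₂ M)
    (hN₁ : N₁.IsModel P₁ lam₁ ρ κ ν₁) (hN₂ : N₂.IsModel P₂ lam₂ ρ κ ν₂) :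
    IsHomogeneousPPP P₁ (N₁.displaced α) (lam₁ * ∫ t, t ^ (2 / α) ∂ν₁) ∧
    N₁.meanDiscovered P₁ α ξ 0 < ⊤ ∧
    N₁.meanDiscovered P₁ α ξ 0 = N₂.meanDiscovered P₂ α ξ 0 := by
  have hα0 : 0 < α := by linarith
  -- The total mass of `κ` is that of its first marginal, a Gamma law.
  have hκp : IsProbabilityMeasure κ := by
    have hms' : (0 : ℝ) < ms := by exact_mod_cast hms
    have := isProbabilityMeasure_gammaMeasure hms' hms'
    constructor
    rw [← Set.preimage_univ (f := Prod.fst), ← Measure.map_apply measurable_fst .univ, hκ.1,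
      measure_univ]
  have := HelloNetwork.isProbabilityMeasure_reducedLaw (κ := κ) hρ0 hρ1 hM
  have := HelloNetwork.isProbabilityMeasure_transmitLaw hρ0 hρ1
  obtain ⟨c₁, hc₁, h₁⟩ := hN₁.exists_hasPoissonLaplace_points hlam₁ hν₁ hρ0 hρ1 hM
  obtain ⟨c₂, hc₂, h₂⟩ := hN₂.exists_hasPoissonLaplace_points hlam₂ hν₂ hρ0 hρ1 hM
  have hT₁ := hN₁.measurable_points α c₁
  have hT₂ := hN₂.measurable_points α c₂
  refine ⟨hN₁.isHomogeneousPPP_displaced hlam₁.le hν₁ hρ0 hρ1 hM, ?_, ?_⟩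
  · rw [hN₁.meanDiscovered_eq_mul hα0 hν₁ hρ0 hρ1 hM ξ hc₁,
      HelloNetwork.lintegral_successCount h₁ hT₁]
    refine ENNReal.mul_lt_top (ENNReal.sum_lt_top.2 fun k _ => ?_) (measure_lt_top _ _)
    have hφ := HelloNetwork.measurable_interferingPower α k
    have hI : Measurable fun ω => ∑' j, HelloNetwork.interferingPower α k (N₁.points α c₁ j ω) :=
      Measurable.tsum fun j => hφ.comp (hT₁ j)
    rcases hρ0.eq_or_lt with rfl | hρ
    · rw [HelloNetwork.prod_successSet_eq_zero hM]
      exact ENNReal.zero_lt_top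
    · refine HelloNetwork.prod_successSet_lt_top hα hξ hρ hρ1 hM hms hmi hκ k fun r => ?_
      have hr : Measurable fun x => negExp (r * x) :=
        measurable_negExp.comp (measurable_id.const_mul r)
      rw [lintegral_map hr hI]
      simp_rw [← ENNReal.tsum_mul_left]
      exact h₁ _ (hφ.const_mul r)
  · rw [hN₁.meanDiscovered_eq_mul hα0 hν₁ hρ0 hρ1 hM ξ hc₁,
      hN₂.meanDiscovered_eq_mul hα0 hν₂ hρ0 hρ1 hM ξ hc₂,
      HelloNetwork.lintegral_successCount h₁ hT₁, HelloNetwork.lintegral_successCount h₂ hT₂]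
    congr 1
    refine Finset.sum_congr rfl fun k _ => ?_
    -- Both intensities are now literally the same, so only the two interference laws remain to be
    -- identified.
    rw [h₁.map_tsum_eq h₂ hT₁ hT₂ (HelloNetwork.measurable_interferingPower α k)]
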